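/- Let $R$ be a countable commutative ring with unit that has infinitely many maximal ideals. Then the theory of $R$-modules is Borel complete. Here the following standard definitions are used. For a countable language $\mathcal L$, let $\mathrm{Str}_{\mathcal L}$ be the Polish space of all $\mathcal L$-structures with universe $\omega$, with its natural topology (the coarsest topology for which the value of every function symbol and the truth value of every relation symbol at every tuple of natural numbers depends continuously on the structure, $\omega$ and $\{0,1\}$ being discrete). For a countable $\mathcal L_{\omega_1\omega}$-theory $T$, let $\mathrm{Mod}(T)\subseteq \mathrm{Str}_{\mathcal L}$ be the Borel set of models of $T$ with universe $\omega$. A countable $\mathcal L_{\omega_1\omega}$-theory $T$ is Borel reducible to a countable $\mathcal L'_{\omega_1\omega}$-theory $S$, written $T\le_B S$, if there is a Borel function $f:\mathrm{Mod}(T)\to\mathrm{Mod}(S)$ such that for all $M,N\in\mathrm{Mod}(T)$, $f(M)\cong f(N)$ if and only if $M\cong N$. The theory $S$ is Borel complete if $T\le_B S$ for every countable language $\mathcal L$ and every countable $\mathcal L_{\omega_1\omega}$-theory $T$. The theory of $R$-modules is the set of axioms of unital $R$-modules in the language $\{+,0,\cdot_r\}_{r\in R}$, where each $\cdot_r$ is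 a unary function symbol for multiplication by $r$. -/

import Mathlib

namespace BorelComplexity

universe u v u' v' w

/-- Formulas of the infinitary logic `L_{ω₁ω}` whose free variables are among `x₀, …, x_{n-1}`:
the logic allows countable conjunctions and (finitary) quantification over elements. In `all φ` the
quantified variable is the last variable `x_n` of `φ`. -/
inductive InfFormula (L : FirstOrder.Language.{u, v}) : ℕ → Type (max u v)
  | falsum {n : ℕ} : InfFormula L n
  | equal {n : ℕ} (t₁ t₂ : L.Term (Fin n)) : InfFormula L n
  | rel {n l : ℕ} (r : L.Relations l) (ts : Fin l → L.Term (Fin n)) : InfFormula L n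
  | imp {n : ℕ} (φ ψ : InfFormula L n) : InfFormula L n
  | all {n : ℕ} (φ : InfFormula L (n + 1)) : InfFormula L n
  | iInf {n : ℕ} (φ : ℕ → InfFormula L n) : InfFormula L n

namespace InfFormula

variable {L : FirstOrder.Language.{u, v}} {n : ℕ}

/-- Negation. -/
def not (φ : InfFormula L n) : InfFormula L n := imp φ falsum

/-- Existential quantification over the last variable. -/
def ex (φ : InfFormula L (n + 1)) : InfFormula L n := not (all (not φ))

/-- Satisfaction of an `L_{ω₁ω}` formula in a structure under an assignment of its variables. -/
def Realize {M : Type w} [L.Structure M] : {n : ℕ} → InfFormula L n → (Fin n → M) → Prop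
  | _, falsum, _ => False
  | _, equal t₁ t₂, v => t₁.realize v = t₂.realize v
  | _, rel r ts, v => FirstOrder.Language.Structure.RelMap r fun i => (ts i).realize v
  | _, imp φ ψ, v => φ.Realize v → ψ.Realize v
  | _, all φ, v => ∀ a : M, φ.Realize (Fin.snoc v a)
  | _, iInf φ, v => ∀ k : ℕ, (φ k).Realize v

end InfFormula

/-- An `L_{ω₁ω}` theory: a set of sentences, i.e. of formulas without free variables. -/
abbrev InfTheory (L : FirstOrder.Language.{u, v}) : Type (max u v) := Set (InfFormula L 0)

/-- `Str_L`, the space of all `L`-structures with universe `ω`. -/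
abbrev Str (L : FirstOrder.Language.{u, v}) : Type (max u v) := L.Structure ℕ

/-- The natural topology on `Str_L`: the coarsest one for which the value of each function symbol and
the truth value of each relation symbol at each tuple is a continuous function of the structure,
where `ℕ` and `Prop` are discrete. Equivalently, the product topology on
`∏_f ℕ^(ℕ^l) × ∏_r 2^(ℕ^l)`. -/
instance strTopology (L : FirstOrder.Language.{u, v}) : TopologicalSpace (Str L) :=
  (⨅ (l : ℕ) (f : L.Functions l) (x : Fin l → ℕ),
      TopologicalSpace.induced (fun M : Str L => M.funMap f x) ⊥) ⊓
    ⨅ (l : ℕ) (r : L.Relations l) (x : Fin l → ℕ),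
      TopologicalSpace.induced (fun M : Str L => M.RelMap r x) ⊥

/-- `Str_L` carries its Borel `σ`-algebra. -/
instance strMeasurableSpace (L : FirstOrder.Language.{u, v}) : MeasurableSpace (Str L) := borel (Str L)

instance strBorelSpace (L : FirstOrder.Language.{u, v}) : BorelSpace (Str L) := ⟨rfl⟩

/-- `Mod(T)`, the space of models of `T` with universe `ω`. -/
def Mod {L : FirstOrder.Language.{u, v}} (T : InfTheory L) : Set (Str L) :=
  {M | ∀ φ ∈ T, @InfFormula.Realize L ℕ M 0 φ Fin.elim0}

/-- Isomorphism of `L`-structures with universe `ω`. -/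
def Iso {L : FirstOrder.Language.{u, v}} (M N : Str L) : Prop :=
  Nonempty (@FirstOrder.Language.Equiv L ℕ ℕ M N)

/-- `T ≤_B S`: there is a Borel function `f : Mod(T) → Mod(S)` such that
`f(M) ≅ f(N)` if and only if `M ≅ N`. -/
def BorelReducible {L : FirstOrder.Language.{u, v}} {L' : FirstOrder.Language.{u', v'}}
    (T : InfTheory L) (S : InfTheory L') : Prop :=
  ∃ f : Mod T → Mod S, Measurable f ∧
    ∀ M N : Mod T, Iso (f M : Str L') (f N : Str L') ↔ Iso (M : Str L) (N : Str L)

/-- `S` is Borel complete: it is maximal for Borel reducibility, i.e. every countable `L_{ω₁ω}` theory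
in a countable language is Borel reducible to it. (Every countable language is isomorphic to
one in `Type`.) -/
def BorelComplete {L' : FirstOrder.Language.{u', v'}} (S : InfTheory L') : Prop :=
  ∀ (L : FirstOrder.Language.{0, 0}) [Countable L.Symbols] (T : InfTheory L), T.Countable →
    BorelReducible T S

/-- The function symbols `0`, `+` and `r · _` (for `r : R`) of the language of `R`-modules. -/
inductive ModuleFunc (R : Type u) : ℕ → Type u
  | zero : ModuleFunc R 0
  | add : ModuleFunc R 2
  | smul (r : R) : ModuleFunc R 1

/-- The language `{+, 0, ·_r}_{r ∈ R}` of (left) `R`-modules. -/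
def moduleLanguage (R : Type u) : FirstOrder.Language.{u, 0} := ⟨ModuleFunc R, fun _ => Empty⟩

section ModuleTheory

variable {R : Type u} {n : ℕ}

/-- The term `0`. -/
def zeroT : (moduleLanguage R).Term (Fin n) :=
  FirstOrder.Language.Term.func (l := 0) (ModuleFunc.zero : ModuleFunc R 0) ![]

/-- The term `s + t`. -/
def addT (s t : (moduleLanguage R).Term (Fin n)) : (moduleLanguage R).Term (Fin n) :=
  FirstOrder.Language.Term.func (l := 2) (ModuleFunc.add : ModuleFunc R 2) ![s, t]

/-- The term `r · t`. -/
def smulT (r : R) (t : (moduleLanguage R).Term (Fin n)) : (moduleLanguage R).Term (Fin n) :=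
  FirstOrder.Language.Term.func (l := 1) (ModuleFunc.smul r : ModuleFunc R 1) ![t]

/-- The variable `x_i` as a term. -/
def varT (i : Fin n) : (moduleLanguage R).Term (Fin n) := FirstOrder.Language.Term.var i

open InfFormula in
/-- The axioms of (left, unital) `R`-modules. -/
inductive IsModuleAxiom (R : Type u) [Ring R] : InfFormula (moduleLanguage R) 0 → Prop
  | add_assoc : IsModuleAxiom R (all (all (all (equal
      (addT (addT (varT 0) (varT 1)) (varT 2)) (addT (varT 0) (addT (varT 1) (varT 2)))))))
  | add_comm : IsModuleAxiom R (all (all (equal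
      (addT (varT 0) (varT 1)) (addT (varT 1) (varT 0)))))
  | zero_add : IsModuleAxiom R (all (equal (addT zeroT (varT 0)) (varT 0)))
  | exists_neg : IsModuleAxiom R (all (ex (equal (addT (varT 0) (varT 1)) zeroT)))
  | smul_add (r : R) : IsModuleAxiom R (all (all (equal
      (smulT r (addT (varT 0) (varT 1))) (addT (smulT r (varT 0)) (smulT r (varT 1))))))
  | add_smul (r s : R) : IsModuleAxiom R (all (equal
      (smulT (r + s) (varT 0)) (addT (smulT r (varT 0)) (smulT s (varT 0)))))
  | mul_smul (r s : R) : IsModuleAxiom R (all (equal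
      (smulT (r * s) (varT 0)) (smulT r (smulT s (varT 0)))))
  | one_smul : IsModuleAxiom R (all (equal (smulT 1 (varT 0)) (varT 0)))

/-- The theory of (left) `R`-modules. -/
def moduleTheory (R : Type u) [Ring R] : InfTheory (moduleLanguage R) :=
  {φ | IsModuleAxiom R φ}

end ModuleTheory

end BorelComplexity

/-! By compactness of `2^R` there are distinct maximal ideals `m_n` converging to a prime `P` that
contains none of them. Put `k_n = R/m_n` and `K = Frac(R/P)`; an element of `K` has residues in the
`k_n`, canonical for almost all `n`. A structure `M` is coded by partial functions `v_i` on `ℕ`. Its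
module consists of the sequences in a product `∏ V_n` of `k_n`-spaces, independent of `M`, that
agree almost everywhere with a `K`-combination of generators `x ∈ ℕ`. Every coordinate has a label,
and each label recurs infinitely often. At a label `i` the space is free on `ℕ`, and the generator
`x` becomes the basis vector `v_i x`, or `0` where `v_i` is undefined.

Module maps act coordinatewise (`map_apply_eq_zero`). To recognise the generators, the remaining
labels `(e, c)` impose the relation `∑ c_l y_l = 0` for every edge `y` of colour `e`. Any
combination of two or more generators vanishes at almost all coordinates of some such label
(`comb_eq_zero`), while a single generator vanishes at none (`single_notMem_colorSpan`). So an
isomorphism sends each generator, almost everywhere, to multiples of one generator. The resulting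
permutation of `ℕ` respects the domains and kernels of all `v_i`, hence yields an isomorphism of the
coded structures.

Conversely, an isomorphism of structures has to lift to a colour-preserving permutation of `ℕ`
(`exists_lift`), so the colouring must be homogeneous. It is built generically: at each `n` a finite
prescription colours lists with largest entry `n` and is obeyed only if admissible; a list without
prescription is its own colour. As every prescription recurs, back-and-forth goes through;
admissibility keeps the generators nonzero.

The reduction is Borel because all these modules are enumerated by one parameter set, finitely
supported `K`-vectors with finitely many corrections (`seqOf`). -/

namespace BorelComplexity

universe u

/-! ### Colourings of finite lists of natural numbers -/

/-- A list without repetitions of length at least two. -/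
def IsEdge (y : List ℕ) : Prop := y.Nodup ∧ 2 ≤ y.length

/-- All entries of `y` are smaller than `n`. -/
def Below (n : ℕ) (y : List ℕ) : Prop := ∀ u ∈ y, u < n

theorem Below.mono {m n : ℕ} {y : List ℕ} (h : Below m y) (hmn : m ≤ n) : Below n y :=
  fun u hu => (h u hu).trans_le hmn

theorem below_sum (y : List ℕ) : Below (y.sum + 1) y :=
  fun _ hu => Nat.lt_succ_of_le (List.le_sum_of_mem hu)

/-- The vector `∑ l, a l • y l` of the free vector space on `ℕ`. -/
noncomputable def edgeVec {k : Type u} [Field k] : (ℕ → k) → List ℕ → (ℕ →₀ k)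
  | _, [] => 0
  | a, x :: y => Finsupp.single x (a 0) + edgeVec (fun l => a (l + 1)) y

section edgeVec

variable {k : Type u} [Field k]

theorem edgeVec_apply_of_notMem (a : ℕ → k) (y : List ℕ) {x : ℕ} (hx : x ∉ y) :
    edgeVec a y x = 0 := by
  induction y generalizing a with
  | nil => rfl
  | cons z y ih =>
    rw [List.mem_cons, not_or] at hx
    simp [edgeVec, ih _ hx.2, Ne.symm hx.1]

theorem edgeVec_apply_ne_zero {a : ℕ → k} (ha : ∀ l, a l ≠ 0) {y : List ℕ} (hy : y.Nodup) {x : ℕ}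
    (hx : x ∈ y) : edgeVec a y x ≠ 0 := by
  induction y generalizing a with
  | nil => simp at hx
  | cons z y ih =>
    rw [List.nodup_cons] at hy
    rcases List.mem_cons.1 hx with rfl | hx
    · simp [edgeVec, edgeVec_apply_of_notMem _ _ hy.1, ha]
    · have hne : z ≠ x := fun h => hy.1 (h ▸ hx)
      simpa [edgeVec, hne] using ih (fun l => ha (l + 1)) hy.2 hx

theorem mapDomain_edgeVec (f : ℕ → ℕ) (a : ℕ → k) (y : List ℕ) :
    Finsupp.mapDomain f (edgeVec a y) = edgeVec a (y.map f) := by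
  induction y generalizing a with
  | nil => simp [edgeVec]
  | cons z y ih => simp [edgeVec, Finsupp.mapDomain_add, Finsupp.mapDomain_single, ih]

end edgeVec

/-- The list `y` with `n` replaced by a marker. -/
def pattern (n : ℕ) (y : List ℕ) : List ℕ := y.map fun u => if u = n then 0 else u + 1

/-- The shift keeps `0` free for the marker, so that one finite set of patterns makes sense at every
`n`. -/
theorem pattern_injective (n : ℕ) : Function.Injective (pattern n) := by
  refine List.map_injective_iff.2 fun u v h => ?_
  split_ifs at h <;> omega

/-- The finite set `S` of pairs (pattern, colour) is admissible for the colours of the lists with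
largest entry `n`, the colouring of the lists with smaller entries being given by `t`. -/
structure Admissible (t : List ℕ → List ℕ) (n : ℕ) (S : Finset (List ℕ × List ℕ)) : Prop where
  below : ∀ q ∈ S, Below n q.2
  functional : ∀ q ∈ S, ∀ q' ∈ S, q.1 = q'.1 → q = q'
  injective : ∀ q ∈ S, ∀ q' ∈ S, q.2 = q'.2 → q = q'
  notMem : ∀ y e, (pattern n y, e) ∈ S → IsEdge y → n ∈ y → Below (n + 1) y →
    ∀ (k : Type u) [Field k] (a : ℕ → k), (∀ l, a l ≠ 0) → Finsupp.single n (1 : k) ∉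
      Submodule.span k (insert (edgeVec a y)
        (edgeVec a '' {z | IsEdge z ∧ Below n z ∧ t z = e}))

variable (pres : ℕ → Finset (List ℕ × List ℕ))

open Classical in
/-- The colouring of lists determined by the prescriptions at the numbers below the first argument:
a list which is not prescribed a colour is its own colour. -/
noncomputable def tag : ℕ → List ℕ → List ℕ
  | 0, y => y
  | n + 1, y =>
    if h : n ∈ y ∧ Below (n + 1) y ∧ Admissible.{u} (tag n) n (pres n) ∧
        ∃ e, (pattern n y, e) ∈ pres n
    then h.2.2.2.choose else tag n y

/-- The colour of a list. -/
noncomputable def color (y : List ℕ) : List ℕ := tag.{u} pres (y.sum + 1) y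

/-- The colour of `y`, whose largest entry is `n`, is prescribed to be `e`. -/
structure Prescribed (n : ℕ) (y e : List ℕ) : Prop where
  mem : n ∈ y
  below : Below (n + 1) y
  admissible : Admissible.{u} (tag.{u} pres n) n (pres n)
  mem_pres : (pattern n y, e) ∈ pres n

variable {pres}

/-- Step `n` recolours only lists that contain `n`, so a colour is settled once all entries have
been passed. -/
theorem tag_stable {n N : ℕ} {y : List ℕ} (hy : Below n y) (hN : n ≤ N) :
    tag.{u} pres N y = tag.{u} pres n y := by
  induction N, hN using Nat.le_induction with
  | base => rfl
  | succ N hN ih =>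
    rw [tag, dif_neg, ih]
    exact fun h => absurd (hy _ h.1) hN.not_gt

theorem color_eq_tag {n : ℕ} {y : List ℕ} (hy : Below n y) :
    color.{u} pres y = tag.{u} pres n y := by
  rw [color, ← tag_stable (below_sum y) (le_max_left _ n), tag_stable hy (le_max_right _ n)]

theorem Prescribed.color_eq {n : ℕ} {y e : List ℕ} (h : Prescribed.{u} pres n y e) :
    color.{u} pres y = e := by
  have h' : n ∈ y ∧ Below (n + 1) y ∧ Admissible.{u} (tag pres n) n (pres n) ∧
    ∃ e, (pattern n y, e) ∈ pres n := ⟨h.mem, h.below, h.admissible, e, h.mem_pres⟩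
  rw [color_eq_tag h.below, tag, dif_pos h']
  -- Functionality identifies the chosen colour with `e`.
  exact congrArg Prod.snd (h.admissible.functional _ h'.2.2.2.choose_spec _ h.mem_pres rfl)

theorem color_cases (y : List ℕ) :
    color.{u} pres y = y ∨ ∃ n, Prescribed.{u} pres n y (color.{u} pres y) := by
  suffices H : ∀ n, tag.{u} pres n y = y ∨ ∃ m, Prescribed.{u} pres m y (tag.{u} pres n y) from H _
  intro n
  induction n with
  | zero => exact .inl rfl
  | succ n ih =>
    by_cases h : n ∈ y ∧ Below (n + 1) y ∧ Admissible.{u} (tag pres n) n (pres n) ∧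
      ∃ e, (pattern n y, e) ∈ pres n
    · rw [tag, dif_pos h]
      exact .inr ⟨n, h.1, h.2.1, h.2.2.1, h.2.2.2.choose_spec⟩
    · rwa [tag, dif_neg h]

theorem Prescribed.eq_of_color {n : ℕ} {y z e : List ℕ} (hy : Prescribed.{u} pres n y e)
    (hz : Prescribed.{u} pres n z e) : y = z :=
  pattern_injective n (congrArg Prod.fst (hy.admissible.injective _ hy.mem_pres _ hz.mem_pres rfl))

theorem Prescribed.below_color {n : ℕ} {y e : List ℕ} (hy : Prescribed.{u} pres n y e) :
    Below n e := hy.admissible.below _ hy.mem_pres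

/-- An obeyed prescription at `n` uses each colour at most once and only colours with entries below
`n`. Hence the largest `n` at which a member of `S` is prescribed belongs to one member only, and
the list `e`, if present, lies below it. -/
theorem exists_top_edge {e : List ℕ} (S : Finset (List ℕ)) (hS : ∀ y ∈ S, color.{u} pres y = e)
    (he : ∃ y ∈ S, y ≠ e) :
    ∃ n, ∃ y ∈ S, Prescribed.{u} pres n y e ∧ ∀ z ∈ S, z ≠ y → Below n z := by
  have hp : ∀ y ∈ S, y ≠ e → ∃ n, Prescribed.{u} pres n y e := fun y hy hye => by
    rcases color_cases.{u} (pres := pres) y with h | h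
    · exact absurd (h.symm.trans (hS y hy)) hye
    · rwa [hS y hy] at h
  have hb : ∃ N, ∀ n, (∃ y ∈ S, Prescribed.{u} pres n y e) → n ≤ N := by
    refine ⟨∑ y ∈ S, y.sum, ?_⟩
    rintro n ⟨y, hy, h⟩
    exact (List.le_sum_of_mem h.mem).trans
      (Finset.single_le_sum (f := fun y : List ℕ => y.sum) (fun _ _ => Nat.zero_le _) hy)
  obtain ⟨y0, hy0, hne⟩ := he
  obtain ⟨n0, hn0⟩ := hp y0 hy0 hne
  classical
  obtain ⟨N, hN⟩ := hb
  obtain ⟨n, ⟨y, hy, h⟩, hmax⟩ : ∃ n, (∃ y ∈ S, Prescribed.{u} pres n y e) ∧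
      ∀ m, (∃ y ∈ S, Prescribed.{u} pres m y e) → m ≤ n :=
    ⟨_, Nat.findGreatest_spec (P := fun n => ∃ y ∈ S, Prescribed.{u} pres n y e)
      (hN n0 ⟨y0, hy0, hn0⟩) ⟨y0, hy0, hn0⟩, fun m hm => Nat.le_findGreatest (hN m hm) hm⟩
  refine ⟨n, y, hy, h, fun z hz hzy => ?_⟩
  by_cases hze : z = e
  · exact hze ▸ h.below_color
  obtain ⟨m, hm⟩ := hp z hz hze
  rcases (hmax m ⟨z, hz, hm⟩).lt_or_eq with hlt | rfl
  · exact hm.below.mono hlt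
  · exact absurd (hm.eq_of_color h) hzy

/-! ### Spans of the edges of one colour -/

section span

variable (pres) {k : Type u} [Field k]

/-- The span of the vectors of the edges of a given colour. -/
noncomputable def colorSpan (a : ℕ → k) (e : List ℕ) : Submodule k (ℕ →₀ k) :=
  Submodule.span k (edgeVec a '' {z | IsEdge z ∧ color.{u} pres z = e})

variable {pres}

/-- In a putative relation the top edge alone meets its largest entry `n`. That coordinate cannot
cancel, so `x = n`, which `Admissible.notMem` excludes. If no edge other than `e` occurs, `e` has
two entries with nonzero coefficients. -/
theorem single_notMem_colorSpan {a : ℕ → k} (ha : ∀ l, a l ≠ 0) (e : List ℕ) (x : ℕ) :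
    Finsupp.single x (1 : k) ∉ colorSpan pres a e := by
  classical
  intro h
  rw [colorSpan, Finsupp.mem_span_image_iff_linearCombination] at h
  obtain ⟨b, hb, hx⟩ := h
  have hbS : ∀ y ∈ b.support, IsEdge y ∧ color.{u} pres y = e := fun y hy => hb hy
  rw [Finsupp.linearCombination_apply, Finsupp.sum] at hx
  by_cases he : ∃ y ∈ b.support, y ≠ e
  · obtain ⟨n, y, hy, hp, htop⟩ := exists_top_edge b.support (fun y hy => (hbS y hy).2) he
    rw [← Finset.add_sum_erase _ _ hy] at hx
    have hn : x = n := by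
      by_contra hxn
      have := DFunLike.congr_fun hx n
      rw [Finsupp.add_apply, Finsupp.finsetSum_apply, Finset.sum_eq_zero, Finsupp.single_apply,
        if_neg hxn, add_zero, Finsupp.smul_apply, smul_eq_mul, mul_eq_zero] at this
      · exact this.elim (Finsupp.mem_support_iff.1 hy)
          (edgeVec_apply_ne_zero ha (hbS y hy).1.1 hp.mem)
      · intro z hz
        rw [Finset.mem_erase] at hz
        rw [Finsupp.smul_apply, edgeVec_apply_of_notMem, smul_zero]
        exact fun hnz => (htop z hz.2 hz.1 _ hnz).false
    subst hn
    refine hp.admissible.notMem y e hp.mem_pres (hbS y hy).1 hp.mem hp.below k a ha ?_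
    rw [← hx]
    refine add_mem (Submodule.smul_mem _ _ (Submodule.subset_span (Set.mem_insert _ _)))
      (sum_mem fun z hz => Submodule.smul_mem _ _ (Submodule.subset_span (Set.mem_insert_of_mem _
        ⟨z, ?_, rfl⟩)))
    rw [Finset.mem_erase] at hz
    have hz' := htop z hz.2 hz.1
    exact ⟨(hbS z hz.2).1, hz', by rw [← color_eq_tag hz', (hbS z hz.2).2]⟩
  · push Not at he
    have hsub : b.support ⊆ {e} := fun y hy => Finset.mem_singleton.2 (he y hy)
    rw [Finset.sum_subset hsub (fun y _ hy => by
      rw [Finsupp.notMem_support_iff.1 hy, zero_smul]), Finset.sum_singleton] at hx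
    have hbe : b e ≠ 0 := by
      intro h0
      rw [h0, zero_smul] at hx
      have := DFunLike.congr_fun hx x
      simp at this
    have hed := (hbS e (Finsupp.mem_support_iff.2 hbe)).1
    obtain ⟨j, hj, hjx⟩ : ∃ j ∈ e, j ≠ x := by
      by_contra! hc
      have h1 : e.toFinset ⊆ {x} := fun j hj =>
        Finset.mem_singleton.2 (hc j (List.mem_toFinset.1 hj))
      have h2 := Finset.card_le_card h1
      rw [List.toFinset_card_of_nodup hed.1, Finset.card_singleton] at h2
      have := hed.2
      omega
    have := DFunLike.congr_fun hx j
    rw [Finsupp.single_apply, if_neg hjx.symm, Finsupp.smul_apply, smul_eq_mul, mul_eq_zero] at this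
    exact this.elim hbe (edgeVec_apply_ne_zero ha hed.1 hj)

variable (pres) in
/-- Prescribed lists whose largest entry belongs to `A` are contained in `A`. -/
def IsClosedSet (A : Set ℕ) : Prop :=
  ∀ n ∈ A, ∀ y e, IsEdge y → Prescribed.{u} pres n y e → ∀ v ∈ y, v ∈ A

/-- Among the edges leaving `A`, the top one is prescribed at a number outside `A`, because `A` is
closed. That number lies on no other edge used, so it survives in the support of `w`, a
contradiction. If only the list `e` leaves `A`, any of its entries outside `A` serves instead. -/
theorem IsClosedSet.mem_span {A : Set ℕ} (hA : IsClosedSet.{u} pres A) {a : ℕ → k}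
    (ha : ∀ l, a l ≠ 0) {e : List ℕ} {w : ℕ →₀ k} (hw : w ∈ colorSpan pres a e)
    (hwA : ∀ x, w x ≠ 0 → x ∈ A) :
    w ∈ Submodule.span k (edgeVec a ''
      {z | IsEdge z ∧ color.{u} pres z = e ∧ ∀ v ∈ z, v ∈ A}) := by
  classical
  rw [colorSpan, Finsupp.mem_span_image_iff_linearCombination] at hw
  obtain ⟨b, hb, hx⟩ := hw
  have hbS : ∀ y ∈ b.support, IsEdge y ∧ color.{u} pres y = e := fun y hy => hb hy
  rw [Finsupp.linearCombination_apply, Finsupp.sum] at hx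
  -- An entry that lies on a single edge of the combination cannot cancel.
  have key : ∀ y ∈ b.support, ∀ j ∈ y, (∀ z ∈ b.support, z ≠ y → j ∉ z) → j ∈ A := by
    intro y hy j hj hz
    refine hwA j ?_
    rw [← hx, ← Finset.add_sum_erase _ _ hy, Finsupp.add_apply, Finsupp.finsetSum_apply,
      Finset.sum_eq_zero, add_zero, Finsupp.smul_apply, smul_eq_mul]
    · exact mul_ne_zero (Finsupp.mem_support_iff.1 hy) (edgeVec_apply_ne_zero ha (hbS y hy).1.1 hj)
    · intro z hz'
      rw [Finset.mem_erase] at hz'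
      rw [Finsupp.smul_apply, edgeVec_apply_of_notMem _ _ (hz z hz'.2 hz'.1), smul_zero]
  have hall : ∀ y ∈ b.support, ∀ v ∈ y, v ∈ A := by
    by_contra hc
    set S := b.support.filter (fun y => ¬ ∀ v ∈ y, v ∈ A) with hSdef
    have hS : ∀ y ∈ S, color.{u} pres y = e := fun y hy => (hbS y (Finset.mem_filter.1 hy).1).2
    have hnot : ∀ j ∉ A, ∀ z ∈ b.support, z ∉ S → j ∉ z := fun j hj z hz hzS hjz =>
      hj (by by_contra hjA; exact hzS (Finset.mem_filter.2 ⟨hz, fun h => hjA (h j hjz)⟩))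
    by_cases he : ∃ y ∈ S, y ≠ e
    · obtain ⟨n, y, hy, hp, htop⟩ := exists_top_edge S hS he
      obtain ⟨hyb, hyA⟩ := Finset.mem_filter.1 hy
      have hn : n ∉ A := fun hn => hyA (hA n hn y e (hbS y hyb).1 hp)
      refine hn (key y hyb n hp.mem fun z hz hzy hnz => ?_)
      by_cases hzS : z ∈ S
      · exact (htop z hzS hzy n hnz).false
      · exact hnot n hn z hz hzS hnz
    · push Not at he hc
      obtain ⟨y, hy, j, hj, hjA⟩ := hc
      refine hjA (key y hy j hj fun z hz hzy => ?_)
      refine hnot j hjA z hz fun hzS => hzy ?_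
      rw [he z hzS, he y (Finset.mem_filter.2 ⟨hy, fun h => hjA (h j hj)⟩)]
  rw [← hx]
  exact sum_mem fun y hy => Submodule.smul_mem _ _ (Submodule.subset_span
    ⟨y, ⟨(hbS y hy).1, (hbS y hy).2, hall y hy⟩, rfl⟩)

end span

end BorelComplexity

namespace BorelComplexity

universe u

/-! ### Lifting permutations -/

variable {T : Type*} {p : ℕ → T} {pres : ℕ → Finset (List ℕ × List ℕ)}

theorem finite_setOf_nodup (B : Finset ℕ) : {w : List ℕ | w.Nodup ∧ ∀ v ∈ w, v ∈ B}.Finite := by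
  refine (B.powerset.biUnion fun s => s.val.lists.toFinset).finite_toSet.subset fun w hw => ?_
  rw [Finset.mem_coe, Finset.mem_biUnion]
  exact ⟨⟨(w : Multiset ℕ), hw.1⟩, Finset.mem_powerset.2 fun v hv => hw.2 v hv, by simp⟩

/-- The first coordinates of the elements of a relation. -/
def relDom (s : Finset (ℕ × ℕ)) : Set ℕ := {x | ∃ y, (x, y) ∈ s}

/-- The second coordinates of the elements of a relation. -/
def relRan (s : Finset (ℕ × ℕ)) : Set ℕ := {y | ∃ x, (x, y) ∈ s}

variable (p pres) in
/-- A finite partial bijection which preserves colours and lies over `H`. -/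
structure IsPartialIso (H : T ≃ T) (s : Finset (ℕ × ℕ)) : Prop where
  inj : ∀ q ∈ s, ∀ q' ∈ s, q.1 = q'.1 ↔ q.2 = q'.2
  closed_dom : IsClosedSet.{u} pres (relDom s)
  closed_ran : IsClosedSet.{u} pres (relRan s)
  color_eq : ∀ zs : List (ℕ × ℕ), (∀ z ∈ zs, z ∈ s) → IsEdge (zs.map Prod.fst) →
    color.{u} pres (zs.map Prod.snd) = color.{u} pres (zs.map Prod.fst)
  map_p : ∀ q ∈ s, p q.2 = H (p q.1)

theorem IsPartialIso.exists_fun {H : T ≃ T} {s : Finset (ℕ × ℕ)}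
    (hs : IsPartialIso.{u} p pres H s) : ∃ f : ℕ → ℕ, ∀ q ∈ s, f q.1 = q.2 := by
  classical
  refine ⟨fun x => if h : ∃ y, (x, y) ∈ s then h.choose else 0, fun q hq => ?_⟩
  have h : ∃ y, (q.1, y) ∈ s := ⟨q.2, hq⟩
  dsimp only
  rw [dif_pos h]
  exact (hs.inj _ h.choose_spec _ hq).1 rfl

theorem IsPartialIso.exists_inv {H : T ≃ T} {s : Finset (ℕ × ℕ)}
    (hs : IsPartialIso.{u} p pres H s) : ∃ g : ℕ → ℕ, ∀ q ∈ s, g q.2 = q.1 := by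
  classical
  refine ⟨fun y => if h : ∃ x, (x, y) ∈ s then h.choose else 0, fun q hq => ?_⟩
  have h : ∃ x, (x, q.2) ∈ s := ⟨q.1, hq⟩
  dsimp only
  rw [dif_pos h]
  exact (hs.inj _ h.choose_spec _ hq).2 rfl

theorem IsPartialIso.swap {H : T ≃ T} {s : Finset (ℕ × ℕ)} (hs : IsPartialIso.{u} p pres H s) :
    IsPartialIso.{u} p pres H.symm (s.image Prod.swap) := by
  have hmem : ∀ q, q ∈ s.image Prod.swap ↔ q.swap ∈ s := fun q => by
    rw [Finset.mem_image]
    exact ⟨by rintro ⟨a, ha, rfl⟩; simpa using ha, fun h => ⟨_, h, by simp⟩⟩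
  have hdom : relDom (s.image Prod.swap) = relRan s := by
    ext x; simp [relDom, relRan, -Finset.mem_image, hmem]
  have hran : relRan (s.image Prod.swap) = relDom s := by
    ext x; simp [relDom, relRan, -Finset.mem_image, hmem]
  refine ⟨fun q hq q' hq' => ?_, hdom ▸ hs.closed_ran, hran ▸ hs.closed_dom, fun zs hz he => ?_,
    fun q hq => ?_⟩
  · exact (hs.inj _ ((hmem q).1 hq) _ ((hmem q').1 hq')).symm
  · have h1 := hs.color_eq (zs.map Prod.swap) (fun z hz' => by
      obtain ⟨q, hq, rfl⟩ := List.mem_map.1 hz'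
      exact (hmem q).1 (hz q hq))
    have e1 : (zs.map Prod.swap).map Prod.fst = zs.map Prod.snd := by rw [List.map_map]; rfl
    have e2 : (zs.map Prod.swap).map Prod.snd = zs.map Prod.fst := by rw [List.map_map]; rfl
    rw [e1, e2] at h1
    refine (h1 ⟨?_, by simpa using he.2⟩).symm
    obtain ⟨f, hf⟩ := hs.exists_fun
    refine List.Nodup.of_map f ?_
    convert he.1 using 1
    rw [List.map_map]
    exact List.map_congr_left fun z hz' => hf _ ((hmem z).1 (hz z hz'))
  · rw [Equiv.eq_symm_apply]
    exact (hs.map_p _ ((hmem q).1 hq)).symm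

theorem apply_eq_zero_of_mem_span {k : Type u} [Field k] {a : ℕ → k} {S : Set (List ℕ)} {j : ℕ}
    (hS : ∀ z ∈ S, j ∉ z) {w : ℕ →₀ k} (hw : w ∈ Submodule.span k (edgeVec a '' S)) : w j = 0 := by
  have : Submodule.span k (edgeVec a '' S) ≤ LinearMap.ker (Finsupp.lapply (R := k) j) := by
    rw [Submodule.span_le]
    rintro _ ⟨z, hz, rfl⟩
    exact edgeVec_apply_of_notMem a z (hS z hz)
  exact this hw

/-- An edge with an entry `y` outside a closed set `A` and all other entries in `A` is prescribed
at `y` or not at all. -/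
theorem IsClosedSet.color_cases {A : Set ℕ} (hA : IsClosedSet.{u} pres A) {y : ℕ} (hy : y ∉ A)
    {w : List ℕ} (hw : IsEdge w) (hyw : y ∈ w) (hwA : ∀ v ∈ w, v = y ∨ v ∈ A) :
    color.{u} pres w = w ∨ Prescribed.{u} pres y w (color.{u} pres w) := by
  rcases BorelComplexity.color_cases.{u} (pres := pres) w with h | ⟨n, h⟩
  · exact .inl h
  · rcases hwA n h.mem with rfl | hn
    · exact .inr h
    · exact absurd (hA n hn w _ hw h y hyw) hy

/-- A list that is its own colour has `y` in its colour, whereas a prescription at `y` uses only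
colours below `y`. So the two kinds of edges share no colour, and within each kind colours are
distinct. -/
theorem IsClosedSet.eq_of_color_eq {A : Set ℕ} (hA : IsClosedSet.{u} pres A) {y : ℕ} (hy : y ∉ A)
    {w w' : List ℕ} (hw : IsEdge w) (hyw : y ∈ w) (hwA : ∀ v ∈ w, v = y ∨ v ∈ A)
    (hw' : IsEdge w') (hyw' : y ∈ w') (hwA' : ∀ v ∈ w', v = y ∨ v ∈ A)
    (h : color.{u} pres w = color.{u} pres w') : w = w' := by
  rcases hA.color_cases hy hw hyw hwA with h1 | h1 <;>
    rcases hA.color_cases hy hw' hyw' hwA' with h2 | h2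
  · rw [← h1, h, h2]
  · rw [← h, h1] at h2
    exact absurd (h2.below_color y hyw) (lt_irrefl _)
  · rw [h, h2] at h1
    exact absurd (h1.below_color y hyw') (lt_irrefl _)
  · rw [h] at h1
    exact h1.eq_of_color h2

/-- Genericity supplies `y'` over `H (p y)` whose prescription copies the colours of the edges
through `y` to their images. It is admissible because a forbidden relation at `y'` would pull back
to one at `y`, against `single_notMem_colorSpan`. The domain stays closed since it already contains
every number below `y`. -/
theorem IsPartialIso.exists_insert
    (hgen : ∀ (t : T) (S : Finset (List ℕ × List ℕ)) (N : ℕ), ∃ n ≥ N, p n = t ∧ pres n = S)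
    {H : T ≃ T} {s : Finset (ℕ × ℕ)} (hs : IsPartialIso.{u} p pres H s) {y : ℕ}
    (hy : y ∉ relDom s) (hlt : ∀ v < y, v ∈ relDom s) :
    ∃ y', IsPartialIso.{u} p pres H (insert (y, y') s) := by
  classical
  obtain ⟨f, hf⟩ := hs.exists_fun
  obtain ⟨g, hg⟩ := hs.exists_inv
  have hfmem : ∀ v ∈ relDom s, (v, f v) ∈ s := by
    rintro v ⟨v', hv⟩
    have := hf _ hv
    dsimp only at this
    rwa [this]
  have hgmem : ∀ v ∈ relRan s, (g v, v) ∈ s := by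
    rintro v ⟨v', hv⟩
    have := hg _ hv
    dsimp only at this
    rwa [this]
  have hEfin : {w : List ℕ | IsEdge w ∧ y ∈ w ∧ ∀ v ∈ w, v = y ∨ v ∈ relDom s}.Finite := by
    refine (finite_setOf_nodup (insert y (s.image Prod.fst))).subset fun w hw => ⟨hw.1.1, ?_⟩
    intro v hv
    rcases hw.2.2 v hv with rfl | hv
    · exact Finset.mem_insert_self _ _
    · exact Finset.mem_insert_of_mem (Finset.mem_image.2 ⟨_, hfmem v hv, rfl⟩)
  set E := hEfin.toFinset with hE
  have memE : ∀ w, w ∈ E ↔ IsEdge w ∧ y ∈ w ∧ ∀ v ∈ w, v = y ∨ v ∈ relDom s := fun w => by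
    rw [hE, Set.Finite.mem_toFinset]; rfl
  -- The bound places `y'` above the range of `s` and above all entries of the copied colours.
  obtain ⟨y', hy'N, hpy', hpres⟩ := hgen (H (p y))
    (E.image fun w => (w.map fun v => if v = y then 0 else f v + 1, color.{u} pres w))
    (∑ w ∈ E, (color.{u} pres w).sum + ∑ q ∈ s, q.2 + 1)
  have hcolor : ∀ w ∈ E, Below y' (color.{u} pres w) := fun w hw => (below_sum _).mono (by
    have := Finset.single_le_sum (f := fun w => (color.{u} pres w).sum)
      (fun _ _ => Nat.zero_le _) hw
    omega)
  have hran : ∀ v ∈ relRan s, v < y' := by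
    rintro v ⟨x, hx⟩
    have := Finset.single_le_sum (f := fun q : ℕ × ℕ => q.2) (fun _ _ => Nat.zero_le _) hx
    dsimp only at this
    omega
  have hfran : ∀ v ∈ relDom s, f v ∈ relRan s := fun v hv => ⟨v, hfmem v hv⟩
  have hne : ∀ v ∈ relDom s, v ≠ y := fun v hv h => hy (h ▸ hv)
  set F : ℕ → ℕ := fun v => if v = y then y' else f v with hF
  set G : ℕ → ℕ := fun v => if v = y' then y else g v with hG
  have hFy : F y = y' := if_pos rfl
  have hGy : G y' = y := if_pos rfl
  have hFf : ∀ v ∈ relDom s, F v = f v := fun v hv => if_neg (hne v hv)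
  have hGg : ∀ v ∈ relRan s, G v = g v := fun v hv => if_neg (hran v hv).ne
  have hGF : ∀ w ∈ E, (w.map F).map G = w := by
    intro w hw
    rw [List.map_map]
    refine (List.map_congr_left fun v hv => ?_).trans (List.map_id w)
    rcases ((memE w).1 hw).2.2 v hv with rfl | hv
    · simp [hFy, hGy]
    · rw [Function.comp_apply, hFf v hv, hGg _ (hfran v hv), hg _ (hfmem v hv), id]
  have hpat : ∀ w ∈ E, pattern y' (w.map F) = w.map fun v => if v = y then 0 else f v + 1 := by
    intro w hw
    rw [pattern, List.map_map]
    refine List.map_congr_left fun v hv => ?_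
    rcases ((memE w).1 hw).2.2 v hv with rfl | hv
    · simp [hFy]
    · simp [hFf v hv, (hran _ (hfran v hv)).ne, hne v hv]
  have hFran : ∀ w ∈ E, ∀ v ∈ w.map F, v = y' ∨ v ∈ relRan s := by
    intro w hw v hv
    obtain ⟨x, hx, rfl⟩ := List.mem_map.1 hv
    rcases ((memE w).1 hw).2.2 x hx with rfl | hx
    · exact .inl hFy
    · exact .inr (hFf x hx ▸ hfran x hx)
  have hFE : ∀ w ∈ E, IsEdge (w.map F) := fun w hw =>
    ⟨.of_map G (by rw [hGF w hw]; exact ((memE w).1 hw).1.1), by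
      simpa using ((memE w).1 hw).1.2⟩
  have hinv : ∀ z e, (pattern y' z, e) ∈ pres y' → ∃ w ∈ E, z = w.map F ∧ e = color.{u} pres w := by
    intro z e h
    rw [hpres, Finset.mem_image] at h
    obtain ⟨w, hw, h⟩ := h
    rw [Prod.mk.injEq, ← hpat w hw] at h
    exact ⟨w, hw, (pattern_injective _ h.1).symm, h.2.symm⟩
  have hEinj : ∀ w ∈ E, ∀ w' ∈ E, color.{u} pres w = color.{u} pres w' → w = w' := by
    intro w hw w' hw' h
    rw [memE] at hw hw'
    exact hs.closed_dom.eq_of_color_eq hy hw.1 hw.2.1 hw.2.2 hw'.1 hw'.2.1 hw'.2.2 h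
  have hadm : Admissible.{u} (tag.{u} pres y') y' (pres y') := by
    constructor
    · intro q hq
      rw [hpres, Finset.mem_image] at hq
      obtain ⟨w, hw, rfl⟩ := hq
      exact hcolor w hw
    · intro q hq q' hq' h
      rw [hpres, Finset.mem_image] at hq hq'
      obtain ⟨w, hw, rfl⟩ := hq
      obtain ⟨w', hw', rfl⟩ := hq'
      dsimp only at h
      rw [← hpat w hw, ← hpat w' hw'] at h
      have h2 := congrArg (List.map G) (pattern_injective _ h)
      rw [hGF w hw, hGF w' hw'] at h2
      rw [h2]
    · intro q hq q' hq' h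
      rw [hpres, Finset.mem_image] at hq hq'
      obtain ⟨w, hw, rfl⟩ := hq
      obtain ⟨w', hw', rfl⟩ := hq'
      rw [hEinj w hw w' hw' h]
    · intro z e hze _ _ _ k _ a ha hmem
      obtain ⟨w, hw, rfl, rfl⟩ := hinv z e hze
      -- The part `w0` from edges below `y'` is supported in the closed range, hence spanned by
      -- edges inside it, and there `G` preserves colours.
      obtain ⟨c, w0, hw0, hsum⟩ := Submodule.mem_span_insert.1 hmem
      have hw0' : w0 ∈ colorSpan pres a (color.{u} pres w) := by
        refine Submodule.span_mono (Set.image_mono ?_) hw0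
        rintro z ⟨h1, h2, h3⟩
        exact ⟨h1, by rw [color_eq_tag h2, h3]⟩
      have hy0 : w0 y' = 0 := apply_eq_zero_of_mem_span
        (fun z (hz : _ ∧ _ ∧ _) hyz => (hz.2.1 y' hyz).false) hw0
      have hsupp : ∀ x, w0 x ≠ 0 → x ∈ relRan s := by
        intro x hx
        have hxy : x ≠ y' := fun h => hx (h ▸ hy0)
        have h1 := DFunLike.congr_fun hsum x
        rw [Finsupp.single_apply, if_neg hxy.symm, Finsupp.add_apply, Finsupp.smul_apply] at h1
        have hxw : x ∈ w.map F := by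
          by_contra hxw
          rw [edgeVec_apply_of_notMem _ _ hxw, smul_zero, zero_add] at h1
          exact hx h1.symm
        exact (hFran w hw x hxw).resolve_left hxy
      have hspan := hs.closed_ran.mem_span ha hw0' hsupp
      have hmap : Finsupp.mapDomain G w0 ∈ colorSpan pres a (color.{u} pres w) := by
        have h1 := Submodule.mem_map_of_mem (f := Finsupp.lmapDomain k k G) hspan
        rw [Submodule.map_span] at h1
        refine Submodule.span_mono ?_ h1
        rintro _ ⟨_, ⟨z, ⟨hz1, hz2, hz3⟩, rfl⟩, rfl⟩
        refine ⟨z.map G, ?_, (mapDomain_edgeVec G a z).symm⟩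
        have hzg : z.map G = (z.map fun v => (g v, v)).map Prod.fst := by
          rw [List.map_map]
          exact List.map_congr_left fun v hv => hGg v (hz3 v hv)
        have hz' : (z.map fun v => (g v, v)).map Prod.snd = z := by
          rw [List.map_map]
          exact List.map_id z
        have hedge : IsEdge (z.map G) := by
          refine ⟨.of_map f ?_, by simpa using hz1.2⟩
          rw [List.map_map]
          convert hz1.1 using 1
          refine (List.map_congr_left fun v hv => ?_).trans (List.map_id z)
          rw [Function.comp_apply, hGg v (hz3 v hv), hf _ (hgmem v (hz3 v hv)), id]
        refine ⟨hedge, ?_⟩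
        rw [← hz2]
        have := hs.color_eq (z.map fun v => (g v, v)) (fun q hq => by
          obtain ⟨v, hv, rfl⟩ := List.mem_map.1 hq
          exact hgmem v (hz3 v hv)) (hzg ▸ hedge)
        rw [hz', ← hzg] at this
        exact this.symm
      refine single_notMem_colorSpan ha (color.{u} pres w) y (pres := pres) ?_
      have h1 := congrArg (Finsupp.mapDomain G) hsum
      rw [Finsupp.mapDomain_single, hGy, Finsupp.mapDomain_add, Finsupp.mapDomain_smul,
        mapDomain_edgeVec, hGF w hw] at h1
      rw [h1]
      exact add_mem (Submodule.smul_mem _ _ (Submodule.subset_span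
        ⟨w, ⟨((memE w).1 hw).1, rfl⟩, rfl⟩)) hmap
  have hpre : ∀ w ∈ E, Prescribed.{u} pres y' (w.map F) (color.{u} pres w) := by
    intro w hw
    refine ⟨List.mem_map.2 ⟨y, ((memE w).1 hw).2.1, hFy⟩, fun v hv => ?_, hadm, ?_⟩
    · rcases hFran w hw v hv with rfl | h
      · exact Nat.lt_succ_self _
      · exact (hran v h).trans (Nat.lt_succ_self _)
    · rw [hpres, hpat w hw]
      exact Finset.mem_image.2 ⟨w, hw, rfl⟩
  have hy'ran : y' ∉ relRan s := fun h => (hran y' h).false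
  have hdom_insert : relDom (insert (y, y') s) = insert y (relDom s) := by
    ext x
    simp [relDom, exists_or]
  have hran_insert : relRan (insert (y, y') s) = insert y' (relRan s) := by
    ext x
    simp [relRan, exists_or]
  refine ⟨y', ?_, ?_, ?_, ?_, ?_⟩
  · have aux : ∀ q ∈ s, (y = q.1 ↔ y' = q.2) := fun q hq =>
      ⟨fun h => absurd ⟨q.2, h ▸ hq⟩ hy, fun h => absurd ⟨q.1, h ▸ hq⟩ hy'ran⟩
    intro q hq q' hq'
    rcases Finset.mem_insert.1 hq with rfl | hq <;> rcases Finset.mem_insert.1 hq' with rfl | hq'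
    · simp
    · exact aux q' hq'
    · rw [eq_comm, aux q hq, eq_comm]
    · exact hs.inj q hq q' hq'
  · rw [hdom_insert]
    rintro n (rfl | hn) z e hz hp v hv
    · rcases (Nat.lt_succ_iff.1 (hp.below v hv)).lt_or_eq with h | h
      · exact .inr (hlt v h)
      · exact .inl h
    · exact .inr (hs.closed_dom n hn z e hz hp v hv)
  · rw [hran_insert]
    rintro n (rfl | hn) z e hz hp v hv
    · obtain ⟨w, hw, rfl, -⟩ := hinv z e hp.mem_pres
      exact hFran w hw v hv
    · exact .inr (hs.closed_ran n hn z e hz hp v hv)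
  · intro zs hzs he
    by_cases hyz : (y, y') ∈ zs
    · have hw : zs.map Prod.fst ∈ E := by
        refine (memE _).2 ⟨he, List.mem_map.2 ⟨_, hyz, rfl⟩, fun v hv => ?_⟩
        obtain ⟨q, hq, rfl⟩ := List.mem_map.1 hv
        rcases Finset.mem_insert.1 (hzs q hq) with rfl | hq
        · exact .inl rfl
        · exact .inr ⟨q.2, hq⟩
      rw [← (hpre _ hw).color_eq, List.map_map]
      congr 1
      refine List.map_congr_left fun q hq => ?_
      rcases Finset.mem_insert.1 (hzs q hq) with rfl | hq
      · exact hFy.symm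
      · rw [Function.comp_apply, hFf q.1 ⟨q.2, hq⟩, hf q hq]
    · refine hs.color_eq zs (fun q hq => ?_) he
      rcases Finset.mem_insert.1 (hzs q hq) with rfl | h
      · exact absurd hq hyz
      · exact h
  · intro q hq
    rcases Finset.mem_insert.1 hq with rfl | hq
    · exact hpy'
    · exact hs.map_p q hq

theorem IsPartialIso.exists_extend
    (hgen : ∀ (t : T) (S : Finset (List ℕ × List ℕ)) (N : ℕ), ∃ n ≥ N, p n = t ∧ pres n = S)
    {H : T ≃ T} {s : Finset (ℕ × ℕ)} (hs : IsPartialIso.{u} p pres H s) (n : ℕ) :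
    ∃ s', IsPartialIso.{u} p pres H s' ∧ s ⊆ s' ∧ ∀ v < n, v ∈ relDom s' := by
  classical
  induction n with
  | zero => exact ⟨s, hs, subset_rfl, by simp⟩
  | succ n ih =>
    obtain ⟨s', hs', hss', hn⟩ := ih
    by_cases hmem : n ∈ relDom s'
    · refine ⟨s', hs', hss', fun v hv => ?_⟩
      rcases (Nat.lt_succ_iff.1 hv).lt_or_eq with h | rfl
      · exact hn v h
      · exact hmem
    · obtain ⟨y', h⟩ := hs'.exists_insert hgen hmem hn
      refine ⟨_, h, hss'.trans (Finset.subset_insert _ _), fun v hv => ?_⟩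
      rcases (Nat.lt_succ_iff.1 hv).lt_or_eq with h | rfl
      · obtain ⟨w, hw⟩ := hn v h
        exact ⟨w, Finset.mem_insert_of_mem hw⟩
      · exact ⟨y', Finset.mem_insert_self _ _⟩

theorem IsPartialIso.exists_extend_ran
    (hgen : ∀ (t : T) (S : Finset (List ℕ × List ℕ)) (N : ℕ), ∃ n ≥ N, p n = t ∧ pres n = S)
    {H : T ≃ T} {s : Finset (ℕ × ℕ)} (hs : IsPartialIso.{u} p pres H s) (n : ℕ) :
    ∃ s', IsPartialIso.{u} p pres H s' ∧ s ⊆ s' ∧ n ∈ relRan s' := by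
  classical
  obtain ⟨s', hs', hss', hn⟩ := hs.swap.exists_extend hgen (n + 1)
  refine ⟨s'.image Prod.swap, by simpa using hs'.swap, fun q hq => ?_, ?_⟩
  · exact Finset.mem_image.2 ⟨q.swap, hss' (Finset.mem_image_of_mem _ hq), by simp⟩
  · obtain ⟨x, hx⟩ := hn n (Nat.lt_succ_self n)
    exact ⟨x, Finset.mem_image.2 ⟨_, hx, rfl⟩⟩

/-- Having a given number in the domain or in the range is a cofinal condition on finite partial
isomorphisms. An ideal meeting these countably many cofinal sets has a permutation as its union. -/
theorem exists_lift
    (hgen : ∀ (t : T) (S : Finset (List ℕ × List ℕ)) (N : ℕ), ∃ n ≥ N, p n = t ∧ pres n = S)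
    (H : T ≃ T) : ∃ f : ℕ ≃ ℕ, (∀ x, p (f x) = H (p x)) ∧
      ∀ y, IsEdge y → color.{u} pres (y.map f) = color.{u} pres y := by
  classical
  let P := {s : Finset (ℕ × ℕ) // IsPartialIso.{u} p pres H s}
  let s0 : P := ⟨∅, ⟨by simp, by simp [IsClosedSet, relDom], by simp [IsClosedSet, relRan],
    fun zs hz he => by
      rw [List.eq_nil_iff_forall_not_mem.2 fun q hq => Finset.notMem_empty q (hz q hq)] at he
      exact absurd he.2 (by simp), by simp⟩⟩
  let D : ℕ ⊕ ℕ → Order.Cofinal P := Sum.elim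
    (fun x => ⟨{s | x ∈ relDom s.1}, fun s => by
      obtain ⟨s', h1, h2, h3⟩ := s.2.exists_extend hgen (x + 1)
      exact ⟨⟨s', h1⟩, h3 x (Nat.lt_succ_self x), h2⟩⟩)
    (fun x => ⟨{s | x ∈ relRan s.1}, fun s => by
      obtain ⟨s', h1, h2, h3⟩ := s.2.exists_extend_ran hgen x
      exact ⟨⟨s', h1⟩, h3, h2⟩⟩)
  let I := Order.idealOfCofinals s0 D
  have hl : ∀ x, ∃ y, ∃ s ∈ I, (x, y) ∈ s.1 := fun x => by
    obtain ⟨s, ⟨y, hy⟩, hs⟩ := Order.cofinal_meets_idealOfCofinals s0 D (.inl x)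
    exact ⟨y, s, hs, hy⟩
  have hr : ∀ y, ∃ x, ∃ s ∈ I, (x, y) ∈ s.1 := fun y => by
    obtain ⟨s, ⟨x, hx⟩, hs⟩ := Order.cofinal_meets_idealOfCofinals s0 D (.inr y)
    exact ⟨x, s, hs, hx⟩
  choose f hf using hl
  choose g hg using hr
  have hinj : ∀ q q' : ℕ × ℕ, (∃ s ∈ I, q ∈ s.1) → (∃ s ∈ I, q' ∈ s.1) →
      (q.1 = q'.1 ↔ q.2 = q'.2) := by
    rintro q q' ⟨s, hs, hq⟩ ⟨s', hs', hq'⟩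
    obtain ⟨t, -, h1, h2⟩ := I.directed s hs s' hs'
    exact t.2.inj q (h1 hq) q' (h2 hq')
  refine ⟨⟨f, g, fun x => ?_, fun y => ?_⟩, fun x => ?_, fun y hy => ?_⟩
  · exact (hinj (g (f x), f x) (x, f x) (hg _) (hf _)).2 rfl
  · exact (hinj (g y, f (g y)) (g y, y) (hf _) (hg _)).1 rfl
  · obtain ⟨s, -, h⟩ := hf x
    exact s.2.map_p _ h
  · have : ∀ y : List ℕ, ∃ s ∈ I, ∀ v ∈ y, (v, f v) ∈ s.1 := by
      intro y
      induction y with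
      | nil => exact ⟨s0, Order.mem_idealOfCofinals _ _, by simp⟩
      | cons v y ih =>
        obtain ⟨s, hs, hy⟩ := ih
        obtain ⟨s', hs', hv⟩ := hf v
        obtain ⟨t, ht, h1, h2⟩ := I.directed s hs s' hs'
        refine ⟨t, ht, fun x hx => ?_⟩
        rcases List.mem_cons.1 hx with rfl | hx
        · exact h2 hv
        · exact h1 (hy x hx)
    obtain ⟨s, -, hs⟩ := this y
    have h1 : (y.map fun v => (v, f v)).map Prod.fst = y := by
      rw [List.map_map]
      exact List.map_id y
    have h2 := s.2.color_eq (y.map fun v => (v, f v)) (fun q hq => by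
      obtain ⟨v, hv, rfl⟩ := List.mem_map.1 hq
      exact hs v hv) (h1.symm ▸ hy)
    rw [h1, List.map_map] at h2
    exact h2

/-- The extra factor `ℕ` in the enumerated product makes every pair recur infinitely often. -/
theorem exists_generic (T : Type*) [Countable T] [Nonempty T] :
    ∃ (p : ℕ → T) (pres : ℕ → Finset (List ℕ × List ℕ)),
      ∀ (t : T) (S : Finset (List ℕ × List ℕ)) (N : ℕ), ∃ n ≥ N, p n = t ∧ pres n = S := by
  obtain ⟨e, he⟩ := exists_surjective_nat ((T × Finset (List ℕ × List ℕ)) × ℕ)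
  refine ⟨fun n => (e n).1.1, fun n => (e n).1.2, fun t S N => ?_⟩
  have hinf : {n | (e n).1 = (t, S)}.Infinite := by
    choose i hi using fun j => he ((t, S), j)
    refine Set.infinite_of_injective_forall_mem (f := i) (fun a b h => ?_) fun j => by
      simp [hi]
    have := (hi a).symm.trans ((congrArg e h).trans (hi b))
    simpa using this
  obtain ⟨n, hn, hN⟩ := hinf.exists_gt N
  have hn' : (e n).1 = (t, S) := hn
  exact ⟨n, hN.le, by simp [hn'], by simp [hn']⟩

end BorelComplexity

namespace BorelComplexity

open Filter

universe u

/-! ### Sequences of maximal ideals converging to a prime ideal -/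

/-- A sequence of distinct maximal ideals which converges to a prime ideal `limit` that contains
none of them. -/
structure MaximalSequence (R : Type u) [CommRing R] where
  ideal : ℕ → Ideal R
  maximal : ∀ n, (ideal n).IsMaximal
  injective : Function.Injective ideal
  limit : Ideal R
  prime : limit.IsPrime
  eventually_mem : ∀ a ∈ limit, ∀ᶠ n in cofinite, a ∈ ideal n
  eventually_notMem : ∀ a ∉ limit, ∀ᶠ n in cofinite, a ∉ ideal n
  not_le : ∀ n, ¬ ideal n ≤ limit

/-- As `R` is countable, `2^R` is sequentially compact, so the indicators of some subsequence of the
ideals converge. The limit is the indicator of a prime ideal, since each instance of the axioms can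
be checked at one late index. -/
theorem exists_maximalSequence (R : Type u) [CommRing R] [Countable R]
    [Infinite (MaximalSpectrum R)] : Nonempty (MaximalSequence R) := by
  classical
  let e := Infinite.natEmbedding (MaximalSpectrum R)
  obtain ⟨χ, φ, hφ, hχ⟩ := CompactSpace.tendsto_subseq
    (fun n (a : R) => decide (a ∈ (e n).asIdeal))
  rw [tendsto_pi_nhds] at hχ
  have hev : ∀ a, ∀ᶠ n in cofinite, (a ∈ (e (φ n)).asIdeal ↔ χ a = true) := by
    intro a
    have := hχ a
    rw [nhds_discrete, tendsto_pure] at this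
    rw [Nat.cofinite_eq_atTop]
    filter_upwards [this] with n hn
    rw [← hn]
    simp
  let P : Ideal R :=
    { carrier := {a | χ a = true}
      add_mem' := fun {a b} ha hb => by
        obtain ⟨n, h1, h2, h3⟩ := ((hev a).and ((hev b).and (hev (a + b)))).exists
        exact h3.1 (add_mem (h1.2 ha) (h2.2 hb))
      zero_mem' := by
        obtain ⟨n, h1⟩ := (hev 0).exists
        exact h1.1 (zero_mem _)
      smul_mem' := fun c a ha => by
        obtain ⟨n, h1, h2⟩ := ((hev a).and (hev (c * a))).exists
        exact h2.1 (Ideal.mul_mem_left _ _ (h1.2 ha)) }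
  have hP : P.IsPrime := by
    refine ⟨fun h => ?_, fun {a b} hab => ?_⟩
    · obtain ⟨n, h1⟩ := (hev 1).exists
      refine (e (φ n)).isMaximal.ne_top ((Ideal.eq_top_iff_one _).2 (h1.2 ?_))
      exact (h ▸ Submodule.mem_top : (1 : R) ∈ P)
    · obtain ⟨n, h1, h2, h3⟩ := ((hev a).and ((hev b).and (hev (a * b)))).exists
      have hn := (e (φ n)).isMaximal.isPrime
      rcases hn.mem_or_mem (h3.2 hab) with h | h
      · exact .inl (h1.1 h)
      · exact .inr (h2.1 h)
  have hinj : Function.Injective fun n => (e (φ n)).asIdeal := fun a b h =>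
    hφ.injective (e.injective (MaximalSpectrum.ext h))
  -- A maximal ideal inside the proper ideal `P` equals `P`, so at most one index is bad; the
  -- sequence starts after it.
  obtain ⟨N, hN⟩ : ∃ N, ∀ n, ¬ (e (φ (n + N))).asIdeal ≤ P := by
    by_cases h : ∃ n, (e (φ n)).asIdeal ≤ P
    · obtain ⟨n, hn⟩ := h
      refine ⟨n + 1, fun j hj => ?_⟩
      have h1 := (e (φ n)).isMaximal.eq_of_le hP.ne_top hn
      have h2 := (e (φ (j + (n + 1)))).isMaximal.eq_of_le hP.ne_top hj
      have := hinj (h1.trans h2.symm)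
      omega
    · push Not at h
      exact ⟨0, fun n => h _⟩
  have hadd : Tendsto (fun n => n + N) cofinite cofinite :=
    (add_left_injective N).tendsto_cofinite
  exact ⟨{
    ideal := fun n => (e (φ (n + N))).asIdeal
    maximal := fun n => (e (φ (n + N))).isMaximal
    injective := fun a b h => add_left_injective N (hinj h)
    limit := P
    prime := hP
    eventually_mem := fun a ha => hadd.eventually ((hev a).mono fun n hn => hn.2 ha)
    eventually_notMem := fun a ha => hadd.eventually ((hev a).mono fun n hn h => ha (hn.1 h))
    not_le := hN }⟩

/-! ### Residue fields, and residues of elements of the limit field -/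

namespace MaximalSequence

variable {R : Type u} [CommRing R] (S : MaximalSequence R)

/-- The residue fields of the maximal ideals. -/
def Residue (n : ℕ) : Type u := R ⧸ S.ideal n

noncomputable instance (n : ℕ) : Field (S.Residue n) :=
  haveI := S.maximal n
  Ideal.Quotient.field (S.ideal n)

noncomputable instance (n : ℕ) : Algebra R (S.Residue n) :=
  (Ideal.Quotient.mk (S.ideal n) : R →+* S.Residue n).toAlgebra

theorem algebraMap_residue_surjective (n : ℕ) :
    Function.Surjective (algebraMap R (S.Residue n)) := Ideal.Quotient.mk_surjective

instance [Countable R] (n : ℕ) : Countable (S.Residue n) :=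
  (S.algebraMap_residue_surjective n).countable

theorem algebraMap_residue_eq_zero {n : ℕ} {a : R} :
    algebraMap R (S.Residue n) a = 0 ↔ a ∈ S.ideal n := Ideal.Quotient.eq_zero_iff_mem

theorem exists_separating {j n : ℕ} (h : j ≠ n) :
    ∃ b : R, algebraMap R (S.Residue j) b = 0 ∧ algebraMap R (S.Residue n) b ≠ 0 := by
  have : ¬ S.ideal j ≤ S.ideal n := fun hle =>
    h (S.injective ((S.maximal j).eq_of_le (S.maximal n).ne_top hle))
  obtain ⟨b, hb, hb'⟩ := SetLike.not_le_iff_exists.1 this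
  exact ⟨b, S.algebraMap_residue_eq_zero.2 hb, mt S.algebraMap_residue_eq_zero.1 hb'⟩

instance : S.limit.IsPrime := S.prime

/-- The residue field of the limit. -/
abbrev LimitField : Type u := FractionRing (R ⧸ S.limit)

theorem exists_div (c : S.LimitField) :
    ∃ r s : R, s ∉ S.limit ∧ c = algebraMap R S.LimitField r / algebraMap R S.LimitField s := by
  obtain ⟨x, y, hy, h⟩ := IsFractionRing.div_surjective (A := R ⧸ S.limit) c
  obtain ⟨r, rfl⟩ := Ideal.Quotient.mk_surjective x
  obtain ⟨s, rfl⟩ := Ideal.Quotient.mk_surjective y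
  refine ⟨r, s, fun hs => nonZeroDivisors.ne_zero hy (Ideal.Quotient.eq_zero_iff_mem.2 hs), ?_⟩
  rw [← h, IsScalarTower.algebraMap_apply R (R ⧸ S.limit) S.LimitField,
    IsScalarTower.algebraMap_apply R (R ⧸ S.limit) S.LimitField]
  rfl

instance [Countable R] : Countable S.LimitField := by
  have : Function.Surjective (fun q : R × R =>
      algebraMap R S.LimitField q.1 / algebraMap R S.LimitField q.2) := fun c => by
    obtain ⟨r, s, -, h⟩ := S.exists_div c
    exact ⟨(r, s), h.symm⟩
  exact this.countable

theorem algebraMap_limitField_eq_zero {a : R} :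
    algebraMap R S.LimitField a = 0 ↔ a ∈ S.limit := by
  rw [IsScalarTower.algebraMap_apply R (R ⧸ S.limit) S.LimitField,
    FaithfulSMul.algebraMap_eq_zero_iff]
  exact Ideal.Quotient.eq_zero_iff_mem

theorem eventually_algebraMap_ne_zero {a : R} (ha : a ∉ S.limit) :
    ∀ᶠ n in cofinite, algebraMap R (S.Residue n) a ≠ 0 :=
  (S.eventually_notMem a ha).mono fun _ h h' => h (S.algebraMap_residue_eq_zero.1 h')

open Classical in
/-- The sequence of residues of an element of the limit field, which is canonical up to finitely
many terms. -/
noncomputable def residue (c : S.LimitField) (n : ℕ) : S.Residue n :=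
  if c = 0 then 0 else algebraMap R (S.Residue n) (S.exists_div c).choose /
    algebraMap R (S.Residue n) (S.exists_div c).choose_spec.choose

@[simp] theorem residue_zero (n : ℕ) : S.residue 0 n = 0 := if_pos rfl

/-- Two fractions for the same element differ, after cross-multiplication, by an element of the
limit prime, which lies in almost all of the maximal ideals. -/
theorem residue_div (r : R) {s : R} (hs : s ∉ S.limit) :
    ∀ᶠ n in cofinite,
      S.residue (algebraMap R S.LimitField r / algebraMap R S.LimitField s) n =
        algebraMap R (S.Residue n) r / algebraMap R (S.Residue n) s := by
  set c := algebraMap R S.LimitField r / algebraMap R S.LimitField s with hc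
  have hs0 : algebraMap R S.LimitField s ≠ 0 := mt S.algebraMap_limitField_eq_zero.1 hs
  by_cases h0 : c = 0
  · have hr : r ∈ S.limit := by
      rw [hc, div_eq_zero_iff] at h0
      exact S.algebraMap_limitField_eq_zero.1 (h0.resolve_right hs0)
    filter_upwards [S.eventually_mem r hr] with n hn
    rw [h0, residue_zero, S.algebraMap_residue_eq_zero.2 hn, zero_div]
  · obtain ⟨ht, htc⟩ := (S.exists_div c).choose_spec.choose_spec
    set r' := (S.exists_div c).choose
    set s' := (S.exists_div c).choose_spec.choose
    have hs0' : algebraMap R S.LimitField s' ≠ 0 := mt S.algebraMap_limitField_eq_zero.1 ht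
    have h1 : r' * s - r * s' ∈ S.limit := by
      rw [← S.algebraMap_limitField_eq_zero, map_sub, map_mul, map_mul, sub_eq_zero]
      rw [htc, div_eq_div_iff hs0' hs0] at hc
      exact hc
    filter_upwards [S.eventually_mem _ h1, S.eventually_algebraMap_ne_zero hs,
      S.eventually_algebraMap_ne_zero ht] with n hn hns hnt
    rw [residue, if_neg h0]
    change algebraMap R (S.Residue n) r' / algebraMap R (S.Residue n) s' = _
    rw [← S.algebraMap_residue_eq_zero, map_sub, map_mul, map_mul, sub_eq_zero] at hn
    rw [div_eq_div_iff hnt hns, hn]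

theorem residue_algebraMap (r : R) :
    ∀ᶠ n in cofinite, S.residue (algebraMap R S.LimitField r) n = algebraMap R (S.Residue n) r := by
  have := S.residue_div r (s := 1) (fun h => S.prime.ne_top ((Ideal.eq_top_iff_one _).2 h))
  simpa using this

theorem residue_add (c d : S.LimitField) :
    ∀ᶠ n in cofinite, S.residue (c + d) n = S.residue c n + S.residue d n := by
  obtain ⟨r, s, hs, rfl⟩ := S.exists_div c
  obtain ⟨r', s', hs', rfl⟩ := S.exists_div d
  have h := S.residue_div (r * s' + s * r') (s := s * s') fun h =>
    (S.prime.mem_or_mem h).elim hs hs'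
  have e1 : algebraMap R S.LimitField s ≠ 0 := mt S.algebraMap_limitField_eq_zero.1 hs
  have e2 : algebraMap R S.LimitField s' ≠ 0 := mt S.algebraMap_limitField_eq_zero.1 hs'
  rw [div_add_div _ _ e1 e2]
  simp only [map_add, map_mul] at h
  filter_upwards [h, S.residue_div r hs, S.residue_div r' hs', S.eventually_algebraMap_ne_zero hs,
    S.eventually_algebraMap_ne_zero hs'] with n h1 h2 h3 h4 h5
  rw [h1, h2, h3, div_add_div _ _ h4 h5]

theorem residue_mul (c d : S.LimitField) :
    ∀ᶠ n in cofinite, S.residue (c * d) n = S.residue c n * S.residue d n := by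
  obtain ⟨r, s, hs, rfl⟩ := S.exists_div c
  obtain ⟨r', s', hs', rfl⟩ := S.exists_div d
  have h := S.residue_div (r * r') (s := s * s') fun h =>
    (S.prime.mem_or_mem h).elim hs hs'
  rw [div_mul_div_comm]
  simp only [map_mul] at h
  filter_upwards [h, S.residue_div r hs, S.residue_div r' hs'] with n h1 h2 h3
  rw [h1, h2, h3, div_mul_div_comm]

theorem residue_ne_zero {c : S.LimitField} (hc : c ≠ 0) :
    ∀ᶠ n in cofinite, S.residue c n ≠ 0 := by
  obtain ⟨r, s, hs, rfl⟩ := S.exists_div c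
  have hr : r ∉ S.limit := fun h => hc (by rw [S.algebraMap_limitField_eq_zero.2 h, zero_div])
  filter_upwards [S.residue_div r hs, S.eventually_algebraMap_ne_zero hs,
    S.eventually_algebraMap_ne_zero hr] with n h1 h2 h3
  rw [h1]
  exact div_ne_zero h3 h2

theorem residue_ne {c d : S.LimitField} (hcd : c ≠ d) :
    ∀ᶠ n in cofinite, S.residue c n ≠ S.residue d n := by
  filter_upwards [S.residue_ne_zero (sub_ne_zero.2 hcd), S.residue_add (c - d) d] with n h1 h2 h3
  rw [sub_add_cancel, h3] at h2
  exact h1 (by simpa using h2)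

end MaximalSequence

end BorelComplexity

namespace BorelComplexity

universe u

open Filter

/-! ### Modules attached to families of partial functions -/

theorem edgeVec_eq_sum {k : Type u} [Field k] {a : ℕ → k} {y : List ℕ} {g : ℕ → k}
    (h : ∀ l x, y[l]? = some x → a l = g x) :
    edgeVec a y = (y.map fun x => Finsupp.single x (g x)).sum := by
  induction y generalizing a with
  | nil => rfl
  | cons z y ih =>
    rw [edgeVec, List.map_cons, List.sum_cons, h 0 z (by simp),
      ih fun l x hl => h (l + 1) x (by simpa using hl)]

namespace MaximalSequence

variable {R : Type u} [CommRing R] (S : MaximalSequence R)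

/-- Labels of the coordinates: a colour with a list of coefficients, or an index. -/
abbrev Label (I : Type*) := (List ℕ × List S.LimitField) ⊕ I

variable {I : Type*}

open Classical in
/-- The residues of a list of elements of the limit field, with zeros replaced by ones. -/
noncomputable def coef (c : List S.LimitField) (n l : ℕ) : S.Residue n :=
  if S.residue (c.getD l 0) n = 0 then 1 else S.residue (c.getD l 0) n

/-- `single_notMem_colorSpan` needs this without exceptions, hence the ones in place of zeros. At
the positions of a list of nonzero elements the replacement affects only finitely many `n`. -/
theorem coef_ne_zero (c : List S.LimitField) (n l : ℕ) : S.coef c n l ≠ 0 := by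
  unfold coef
  split_ifs with h
  · exact one_ne_zero
  · exact h

theorem coef_eq {c : List S.LimitField} {n l : ℕ} (h : S.residue (c.getD l 0) n ≠ 0) :
    S.coef c n l = S.residue (c.getD l 0) n := if_neg h

variable (pres : ℕ → Finset (List ℕ × List ℕ)) (lab : ℕ → S.Label I)

/-- The relations imposed at a coordinate with a given label. -/
noncomputable def relations (n : ℕ) : S.Label I → Submodule (S.Residue n) (ℕ →₀ S.Residue n)
  | .inl q => colorSpan pres (S.coef q.2 n) q.1
  | .inr _ => ⊥

/-- The coordinate spaces. -/
def Fiber (n : ℕ) : Type u := (ℕ →₀ S.Residue n) ⧸ S.relations pres n (lab n)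

noncomputable instance (n : ℕ) : AddCommGroup (S.Fiber pres lab n) :=
  inferInstanceAs (AddCommGroup ((ℕ →₀ S.Residue n) ⧸ S.relations pres n (lab n)))

noncomputable instance (n : ℕ) : Module (S.Residue n) (S.Fiber pres lab n) :=
  inferInstanceAs (Module (S.Residue n) ((ℕ →₀ S.Residue n) ⧸ S.relations pres n (lab n)))

noncomputable instance (n : ℕ) : Module R (S.Fiber pres lab n) :=
  Module.compHom _ (algebraMap R (S.Residue n))

instance (n : ℕ) : IsScalarTower R (S.Residue n) (S.Fiber pres lab n) :=
  .of_algebraMap_smul fun _ _ => rfl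

/-- The projection to a coordinate space. -/
noncomputable def mkFiber (n : ℕ) : (ℕ →₀ S.Residue n) →ₗ[S.Residue n] S.Fiber pres lab n :=
  (S.relations pres n (lab n)).mkQ

theorem mkFiber_surjective (n : ℕ) : Function.Surjective (S.mkFiber pres lab n) :=
  Submodule.mkQ_surjective _

theorem mkFiber_eq_zero {n : ℕ} {w : ℕ →₀ S.Residue n} :
    S.mkFiber pres lab n w = 0 ↔ w ∈ S.relations pres n (lab n) :=
  Submodule.Quotient.mk_eq_zero _

theorem mkFiber_injective {n : ℕ} {i : I} (h : lab n = .inr i) :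
    Function.Injective (S.mkFiber pres lab n) := by
  rw [injective_iff_map_eq_zero]
  intro w hw
  rw [mkFiber_eq_zero, h] at hw
  exact (Submodule.mem_bot _).1 hw

instance [Countable R] (n : ℕ) : Countable (S.Fiber pres lab n) :=
  (S.mkFiber_surjective pres lab n).countable

/-- The vector that represents `x` at a coordinate with a given label. -/
noncomputable def labelVec (v : I → ℕ → Option ℕ) (n : ℕ) (x : ℕ) : S.Label I → ℕ →₀ S.Residue n
  | .inl _ => .single x 1
  | .inr i => (v i x).elim 0 fun b => .single b 1

/-- The coordinate of the generator `x`. -/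
noncomputable def gen (v : I → ℕ → Option ℕ) (x n : ℕ) : S.Fiber pres lab n :=
  S.mkFiber pres lab n (S.labelVec v n x (lab n))

theorem gen_ne_zero_of_inl (v : I → ℕ → Option ℕ) {x n : ℕ} {q : List ℕ × List S.LimitField}
    (h : lab n = .inl q) : S.gen pres lab v x n ≠ 0 := by
  rw [gen, Ne, mkFiber_eq_zero, h]
  exact single_notMem_colorSpan (S.coef_ne_zero q.2 n) q.1 x

theorem gen_of_inr (v : I → ℕ → Option ℕ) {x n : ℕ} {i : I} (h : lab n = .inr i) :
    S.gen pres lab v x n = S.mkFiber pres lab n ((v i x).elim 0 fun b => .single b 1) := by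
  rw [gen, h]
  rfl

/-- A combination of generators. -/
noncomputable def comb (v : I → ℕ → Option ℕ) (κ : ℕ →₀ S.LimitField) (n : ℕ) :
    S.Fiber pres lab n :=
  κ.sum fun x c => S.residue c n • S.gen pres lab v x n

variable (v : I → ℕ → Option ℕ)

theorem comb_zero (n : ℕ) : S.comb pres lab v 0 n = 0 := Finsupp.sum_zero_index

theorem comb_single (x : ℕ) (c : S.LimitField) (n : ℕ) :
    S.comb pres lab v (.single x c) n = S.residue c n • S.gen pres lab v x n :=
  Finsupp.sum_single_index (by simp)

theorem comb_eq_sum {κ : ℕ →₀ S.LimitField} {s : Finset ℕ} (h : κ.support ⊆ s) (n : ℕ) :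
    S.comb pres lab v κ n = ∑ x ∈ s, S.residue (κ x) n • S.gen pres lab v x n :=
  Finsupp.sum_of_support_subset _ h _ (by simp)

theorem comb_add (κ κ' : ℕ →₀ S.LimitField) : ∀ᶠ n in cofinite,
    S.comb pres lab v (κ + κ') n = S.comb pres lab v κ n + S.comb pres lab v κ' n := by
  classical
  have h : ∀ᶠ n in cofinite, ∀ x ∈ κ.support ∪ κ'.support,
      S.residue (κ x + κ' x) n = S.residue (κ x) n + S.residue (κ' x) n :=
    (eventually_all_finset _).2 fun x _ => S.residue_add _ _
  filter_upwards [h] with n hn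
  rw [S.comb_eq_sum pres lab v (κ := κ) (s := κ.support ∪ κ'.support) Finset.subset_union_left,
    S.comb_eq_sum pres lab v (κ := κ') (s := κ.support ∪ κ'.support) Finset.subset_union_right,
    S.comb_eq_sum pres lab v Finsupp.support_add, ← Finset.sum_add_distrib]
  exact Finset.sum_congr rfl fun x hx => by rw [Finsupp.add_apply, hn x hx, add_smul]

theorem comb_smul (c : S.LimitField) (κ : ℕ →₀ S.LimitField) : ∀ᶠ n in cofinite,
    S.comb pres lab v (c • κ) n = S.residue c n • S.comb pres lab v κ n := by
  have h : ∀ᶠ n in cofinite, ∀ x ∈ κ.support,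
      S.residue (c * κ x) n = S.residue c n * S.residue (κ x) n :=
    (eventually_all_finset _).2 fun x _ => S.residue_mul _ _
  filter_upwards [h] with n hn
  rw [S.comb_eq_sum pres lab v Finsupp.support_smul,
    S.comb_eq_sum pres lab v (κ := κ) subset_rfl, Finset.smul_sum]
  exact Finset.sum_congr rfl fun x hx => by
    rw [Finsupp.smul_apply, smul_eq_mul, hn x hx]
    exact (smul_smul _ _ _).symm

theorem residue_algebraMap_smul (r : R) : ∀ᶠ n in cofinite, ∀ w : S.Fiber pres lab n,
    S.residue (algebraMap R S.LimitField r) n • w = r • w :=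
  (S.residue_algebraMap r).mono fun n hn w => by rw [hn, algebraMap_smul]

/-- The module of sequences which agree almost everywhere with a combination of generators. -/
noncomputable def sequences : Submodule R (∀ n, S.Fiber pres lab n) where
  carrier := {w | ∃ κ, ∀ᶠ n in cofinite, w n = S.comb pres lab v κ n}
  zero_mem' := ⟨0, .of_forall fun n => (S.comb_zero pres lab v n).symm⟩
  add_mem' := by
    rintro w w' ⟨κ, h⟩ ⟨κ', h'⟩
    refine ⟨κ + κ', ?_⟩
    filter_upwards [h, h', S.comb_add pres lab v κ κ'] with n h1 h2 h3
    rw [Pi.add_apply, h1, h2, h3]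
  smul_mem' := by
    rintro r w ⟨κ, h⟩
    refine ⟨algebraMap R S.LimitField r • κ, ?_⟩
    filter_upwards [h, S.comb_smul pres lab v (algebraMap R S.LimitField r) κ,
      S.residue_algebraMap_smul pres lab r] with n h1 h2 h3
    rw [Pi.smul_apply, h1, h2, h3]

/-- The generator `x`. -/
noncomputable def genSeq (x : ℕ) : S.sequences pres lab v :=
  ⟨fun n => S.gen pres lab v x n, .single x 1, by
    filter_upwards [S.residue_algebraMap_smul pres lab 1] with n h
    rw [comb_single]
    simpa using (h (S.gen pres lab v x n)).symm⟩

@[simp] theorem genSeq_apply (x n : ℕ) :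
    (S.genSeq pres lab v x).1 n = S.gen pres lab v x n := rfl

/-! #### Isomorphisms from permutations -/

variable {pres lab v}

/-- At a colour label, permuting the basis by `f` permutes the relations. At an index label there
are no relations, and `π i` renames the basis. -/
theorem exists_relations_equiv {v' : I → ℕ → Option ℕ} {f : ℕ ≃ ℕ} {π : I → ℕ ≃ ℕ}
    (hf : ∀ y, IsEdge y → color.{u} pres (y.map f) = color.{u} pres y)
    (hπ : ∀ i x, v' i (f x) = (v i x).map (π i)) (n : ℕ) (t : S.Label I) :
    ∃ e : (ℕ →₀ S.Residue n) ≃ₗ[S.Residue n] (ℕ →₀ S.Residue n),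
      (S.relations pres n t).map (e : _ →ₗ[S.Residue n] _) = S.relations pres n t ∧
      ∀ x, e (S.labelVec v n x t) = S.labelVec v' n (f x) t := by
  rcases t with q | i
  · refine ⟨Finsupp.domLCongr f, ?_, fun x => by simp [labelVec]⟩
    simp only [relations, colorSpan]
    rw [Submodule.map_span]
    congr 1
    ext w
    constructor
    · rintro ⟨_, ⟨y, ⟨hy, hc⟩, rfl⟩, rfl⟩
      refine ⟨y.map f, ⟨⟨hy.1.map f.injective, by simpa using hy.2⟩, (hf y hy).trans hc⟩, ?_⟩
      rw [← mapDomain_edgeVec]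
      simp [Finsupp.equivMapDomain_eq_mapDomain]
    · rintro ⟨y, ⟨hy, hc⟩, rfl⟩
      have h1 : (y.map f.symm).map f = y := by simp
      have hy' : IsEdge (y.map f.symm) := ⟨hy.1.map f.symm.injective, by simpa using hy.2⟩
      refine ⟨_, ⟨y.map f.symm, ⟨hy', ?_⟩, rfl⟩, ?_⟩
      · rw [← hf _ hy', h1, hc]
      · conv_rhs => rw [← h1, ← mapDomain_edgeVec]
        simp [Finsupp.equivMapDomain_eq_mapDomain]
  · refine ⟨Finsupp.domLCongr (π i), by simp [relations], fun x => ?_⟩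
    simp only [labelVec, hπ]
    cases v i x <;> simp

theorem exists_fiber_equiv {v' : I → ℕ → Option ℕ} {f : ℕ ≃ ℕ} {π : I → ℕ ≃ ℕ}
    (hf : ∀ y, IsEdge y → color.{u} pres (y.map f) = color.{u} pres y)
    (hπ : ∀ i x, v' i (f x) = (v i x).map (π i)) (n : ℕ) :
    ∃ e : S.Fiber pres lab n ≃ₗ[S.Residue n] S.Fiber pres lab n,
      ∀ x, e (S.gen pres lab v x n) = S.gen pres lab v' (f x) n := by
  obtain ⟨e, h1, h2⟩ := S.exists_relations_equiv hf hπ n (lab n)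
  refine ⟨Submodule.Quotient.equiv _ _ e h1, fun x => ?_⟩
  change S.mkFiber pres lab n (e (S.labelVec v n x (lab n))) = _
  rw [h2, gen]

theorem map_mem_sequences {v' : I → ℕ → Option ℕ} {f : ℕ ≃ ℕ}
    {e : ∀ n, S.Fiber pres lab n ≃ₗ[S.Residue n] S.Fiber pres lab n}
    (he : ∀ n x, e n (S.gen pres lab v x n) = S.gen pres lab v' (f x) n)
    {w : ∀ n, S.Fiber pres lab n} (hw : w ∈ S.sequences pres lab v) :
    (fun n => e n (w n)) ∈ S.sequences pres lab v' := by
  obtain ⟨κ, h⟩ := hw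
  refine ⟨κ.mapDomain f, h.mono fun n hn => ?_⟩
  dsimp only
  rw [hn, comb, comb, Finsupp.sum_mapDomain_index_inj f.injective, Finsupp.sum, map_sum]
  exact Finset.sum_congr rfl fun x _ => by rw [map_smul, he]

theorem nonempty_sequences_equiv {v' : I → ℕ → Option ℕ} {f : ℕ ≃ ℕ} {π : I → ℕ ≃ ℕ}
    (hf : ∀ y, IsEdge y → color.{u} pres (y.map f) = color.{u} pres y)
    (hπ : ∀ i x, v' i (f x) = (v i x).map (π i)) :
    Nonempty (S.sequences pres lab v ≃ₗ[R] S.sequences pres lab v') := by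
  choose e he using fun n => S.exists_fiber_equiv (lab := lab) hf hπ n
  have he' : ∀ n x, (e n).symm (S.gen pres lab v' x n) = S.gen pres lab v (f.symm x) n :=
    fun n x => by rw [LinearEquiv.symm_apply_eq, he, f.apply_symm_apply]
  refine ⟨(LinearEquiv.piCongrRight fun n => (e n).restrictScalars R).ofSubmodules _ _ ?_⟩
  ext w
  constructor
  · rintro ⟨w, hw, rfl⟩
    exact S.map_mem_sequences he hw
  · intro hw
    exact ⟨_, S.map_mem_sequences (e := fun n => (e n).symm) he' hw, by ext n; simp⟩

end MaximalSequence

end BorelComplexity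

namespace BorelComplexity

universe u

open Filter

namespace MaximalSequence

variable {R : Type u} [CommRing R] (S : MaximalSequence R) {I : Type*}
  {pres : ℕ → Finset (List ℕ × List ℕ)} {lab : ℕ → S.Label I} {v v' : I → ℕ → Option ℕ}

/-! #### Permutations from isomorphisms -/

theorem fiber_smul_eq_zero {n : ℕ} {r : R} (hr : algebraMap R (S.Residue n) r = 0)
    (w : S.Fiber pres lab n) : r • w = 0 := by
  rw [← algebraMap_smul (S.Residue n) r w, hr, zero_smul]

theorem eq_zero_of_fiber_smul {n : ℕ} {r : R} (hr : algebraMap R (S.Residue n) r ≠ 0)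
    {w : S.Fiber pres lab n} (h : r • w = 0) : w = 0 := by
  rw [← algebraMap_smul (S.Residue n) r w] at h
  exact (smul_eq_zero.1 h).resolve_left hr

theorem exists_separating_finset (F : Finset ℕ) (n : ℕ) :
    ∃ b : R, algebraMap R (S.Residue n) b ≠ 0 ∧
      ∀ j ∈ F, j ≠ n → algebraMap R (S.Residue j) b = 0 := by
  classical
  induction F using Finset.induction_on with
  | empty => exact ⟨1, by simp, by simp⟩
  | insert j F _ ih =>
    obtain ⟨b, hb, h⟩ := ih
    by_cases hj : j = n
    · refine ⟨b, hb, fun i hi hin => ?_⟩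
      rcases Finset.mem_insert.1 hi with rfl | hi
      · exact absurd hj hin
      · exact h i hi hin
    · obtain ⟨c, hc, hc'⟩ := S.exists_separating hj
      refine ⟨c * b, by rw [map_mul]; exact mul_ne_zero hc' hb, fun i hi hin => ?_⟩
      rw [map_mul]
      rcases Finset.mem_insert.1 hi with rfl | hi
      · rw [hc, zero_mul]
      · rw [h i hi hin, mul_zero]

/-- An element `a` of `m_n` outside the limit is invertible at almost all coordinates, so `w` equals
some `a u` up to finitely many of them. Some `b` kills these exceptions but is nonzero at `n`,
whence `b w = b a u`. The images satisfy the same equation, and `a` acts as zero at `n`. -/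
theorem map_apply_eq_zero (Φ : S.sequences pres lab v →ₗ[R] S.sequences pres lab v')
    {w : S.sequences pres lab v} {n : ℕ} (hw : w.1 n = 0) : (Φ w).1 n = 0 := by
  classical
  obtain ⟨a, han, hal⟩ := SetLike.not_le_iff_exists.1 (S.not_le n)
  have han0 : algebraMap R (S.Residue n) a = 0 := S.algebraMap_residue_eq_zero.2 han
  obtain ⟨κ, hκ⟩ := w.2
  -- At the finitely many `j` where `a` vanishes, the inverse takes the default value `0`.
  let u : S.sequences pres lab v := ⟨fun j => (algebraMap R (S.Residue j) a)⁻¹ • w.1 j,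
    (algebraMap R S.LimitField 1 / algebraMap R S.LimitField a) • κ, by
      filter_upwards [hκ, S.comb_smul pres lab v
        (algebraMap R S.LimitField 1 / algebraMap R S.LimitField a) κ, S.residue_div 1 hal]
        with j h1 h2 h3
      rw [h2, h3, h1, map_one, one_div]⟩
  have hfin : {j | ¬ algebraMap R (S.Residue j) a ≠ 0}.Finite :=
    S.eventually_algebraMap_ne_zero hal
  obtain ⟨b, hb, hbj⟩ := S.exists_separating_finset hfin.toFinset n
  have hz : b • (w - a • u) = 0 := by
    ext j
    change b • (w.1 j - a • (algebraMap R (S.Residue j) a)⁻¹ • w.1 j) = 0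
    by_cases hj : algebraMap R (S.Residue j) a = 0
    · by_cases hjn : j = n
      · subst hjn
        rw [hw, smul_zero, smul_zero, sub_zero, smul_zero]
      · exact S.fiber_smul_eq_zero (hbj j (by simpa using hj) hjn) _
    · rw [← algebraMap_smul (S.Residue j) a, smul_smul, mul_inv_cancel₀ hj, one_smul, sub_self,
        smul_zero]
  have h1 := congrArg (fun z => (Φ z).1 n) hz
  simp only [map_smul, map_sub, map_zero] at h1
  have h2 := S.eq_zero_of_fiber_smul hb (w := (Φ w).1 n - a • (Φ u).1 n) h1
  rwa [S.fiber_smul_eq_zero han0, sub_zero] at h2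

theorem map_apply_smul (Φ : S.sequences pres lab v →ₗ[R] S.sequences pres lab v')
    {w w' : S.sequences pres lab v} {n : ℕ} {c : S.Residue n} (hw : w.1 n = c • w'.1 n) :
    (Φ w).1 n = c • (Φ w').1 n := by
  obtain ⟨r, rfl⟩ := S.algebraMap_residue_surjective n c
  have h := S.map_apply_eq_zero Φ (w := w - r • w') (n := n) (by
    change w.1 n - r • w'.1 n = 0
    rw [hw, algebraMap_smul, sub_self])
  rw [map_sub, map_smul] at h
  rw [algebraMap_smul]
  exact sub_eq_zero.1 h

theorem map_apply_eq_zero_iff (Φ : S.sequences pres lab v ≃ₗ[R] S.sequences pres lab v')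
    {w : S.sequences pres lab v} {n : ℕ} : (Φ w).1 n = 0 ↔ w.1 n = 0 := by
  refine ⟨fun h => ?_, S.map_apply_eq_zero Φ.toLinearMap⟩
  have := S.map_apply_eq_zero Φ.symm.toLinearMap h
  simpa using this

/-- The support, listed as an edge `y` with its coefficients, is itself a relation imposed at the
label made of the colour and coefficients of `y`. -/
theorem comb_eq_zero {κ : ℕ →₀ S.LimitField} (hκ : 2 ≤ κ.support.card) :
    ∃ t : List ℕ × List S.LimitField, ∀ᶠ n in cofinite, lab n = .inl t →
      S.comb pres lab v κ n = 0 := by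
  set y := κ.support.toList with hy
  have hedge : IsEdge y := ⟨κ.support.nodup_toList, by rwa [hy, Finset.length_toList]⟩
  refine ⟨(color.{u} pres y, y.map κ), ?_⟩
  have h : ∀ᶠ n in cofinite, ∀ x ∈ κ.support, S.residue (κ x) n ≠ 0 :=
    (eventually_all_finset _).2 fun x hx => S.residue_ne_zero (Finsupp.mem_support_iff.1 hx)
  filter_upwards [h] with n hn hlab
  have h1 : edgeVec (S.coef (y.map κ) n) y =
      ∑ x ∈ κ.support, Finsupp.single x (S.residue (κ x) n) := by
    rw [← Finset.sum_map_toList]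
    refine edgeVec_eq_sum fun l x hl => ?_
    have h2 : (y.map κ).getD l 0 = κ x := by
      rw [List.getD_eq_getElem?_getD, List.getElem?_map, hl]
      rfl
    have h3 : x ∈ κ.support := Finset.mem_toList.1 (List.mem_of_getElem? hl)
    rw [coef_eq, h2]
    rw [h2]
    exact hn x h3
  have h4 : S.comb pres lab v κ n =
      S.mkFiber pres lab n (∑ x ∈ κ.support, Finsupp.single x (S.residue (κ x) n)) := by
    rw [S.comb_eq_sum pres lab v subset_rfl, map_sum]
    refine Finset.sum_congr rfl fun x _ => ?_
    rw [gen, hlab, labelVec, ← map_smul, Finsupp.smul_single, smul_eq_mul, mul_one]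
  rw [h4, mkFiber_eq_zero, hlab, ← h1]
  exact Submodule.subset_span ⟨y, ⟨hedge, rfl⟩, rfl⟩

variable (hlab : ∀ t, ∃ᶠ n in cofinite, lab n = t)
include hlab

/-- The image of a generator is nonzero at every coordinate with a colour label, so the combination
representing it has neither zero terms nor, by `comb_eq_zero`, two or more. -/
theorem exists_map_genSeq (Φ : S.sequences pres lab v ≃ₗ[R] S.sequences pres lab v') (x : ℕ) :
    ∃ z, ∃ c : ∀ n, S.Residue n, ∀ᶠ n in cofinite, c n ≠ 0 ∧
      (Φ (S.genSeq pres lab v x)).1 n = c n • S.gen pres lab v' z n := by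
  obtain ⟨κ, hκ⟩ := (Φ (S.genSeq pres lab v x)).2
  have key : ∀ t, ¬ ∀ᶠ n in cofinite, lab n = .inl t → S.comb pres lab v' κ n = 0 := by
    intro t ht
    obtain ⟨n, hn, h1, h2⟩ := ((hlab (.inl t)).and_eventually (hκ.and ht)).exists
    rw [h2 hn, map_apply_eq_zero_iff] at h1
    exact S.gen_ne_zero_of_inl pres lab v hn h1
  have h1 : κ.support.card = 1 := by
    rcases Nat.lt_or_ge κ.support.card 2 with h | h
    · have : κ.support.card ≠ 0 := fun h0 => by
        rw [Finset.card_eq_zero, Finsupp.support_eq_empty] at h0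
        refine key ([], []) (.of_forall fun n _ => ?_)
        rw [h0, comb_zero]
      omega
    · obtain ⟨t, ht⟩ := S.comb_eq_zero (pres := pres) (lab := lab) (v := v') h
      exact absurd ht (key t)
  obtain ⟨z, c, hc, rfl⟩ := Finsupp.card_support_eq_one'.1 h1
  refine ⟨z, S.residue c, ?_⟩
  filter_upwards [hκ, S.residue_ne_zero hc] with n h2 h3
  exact ⟨h3, by rw [h2, comb_single]⟩

omit hlab in
theorem smul_elim_inj {k : Type*} [Field k] {a b : Option ℕ} {c d : k} (hc : c ≠ 0) (hd : d ≠ 0)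
    (h : c • (a.elim 0 fun x => Finsupp.single x 1 : ℕ →₀ k) =
      d • (b.elim 0 fun x => Finsupp.single x 1)) : a = b := by
  rcases a with _ | a <;> rcases b with _ | b
  · rfl
  · simp [hd, eq_comm] at h
  · simp [hc] at h
  · simp only [Option.elim_some, Finsupp.smul_single, smul_eq_mul, mul_one] at h
    rw [(Finsupp.single_left_inj hc).1 (h.trans ?_)]
    rcases (Finsupp.single_eq_single_iff _ _ _ _).1 h with h | h
    · rw [h.2]
    · exact absurd h.1 hc

/-- At a coordinate with label `i` the fiber is free: vanishing of generators there detects the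
domain of `v i`, and coincidence of generators its kernel. -/
theorem eq_of_map_genSeq (Φ : S.sequences pres lab v ≃ₗ[R] S.sequences pres lab v')
    {f : ℕ → ℕ} {c : ℕ → ∀ n, S.Residue n}
    (hf : ∀ x, ∀ᶠ n in cofinite, c x n ≠ 0 ∧
      (Φ (S.genSeq pres lab v x)).1 n = c x n • S.gen pres lab v' (f x) n) (i : I) :
    (∀ x, (v i x).isSome → (v' i (f x)).isSome) ∧
      ∀ x y, v i x = v i y → v' i (f x) = v' i (f y) := by
  constructor
  · intro x hx
    obtain ⟨n, hn, h1, h2⟩ := ((hlab (.inr i)).and_eventually (hf x)).exists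
    by_contra h
    rw [Option.not_isSome_iff_eq_none] at h
    rw [S.gen_of_inr pres lab v' hn, h, Option.elim_none, map_zero, smul_zero,
      map_apply_eq_zero_iff, genSeq_apply, S.gen_of_inr pres lab v hn,
      map_eq_zero_iff _ (S.mkFiber_injective pres lab hn)] at h2
    obtain ⟨b, hb⟩ := Option.isSome_iff_exists.1 hx
    rw [hb] at h2
    simp at h2
  · intro x y hxy
    obtain ⟨n, hn, ⟨h1, h2⟩, h3, h4⟩ :=
      ((hlab (.inr i)).and_eventually ((hf x).and (hf y))).exists
    have h5 := S.map_apply_smul Φ.toLinearMap (w := S.genSeq pres lab v x)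
      (w' := S.genSeq pres lab v y) (n := n) (c := 1) (by
        rw [one_smul, genSeq_apply, genSeq_apply, S.gen_of_inr pres lab v hn,
          S.gen_of_inr pres lab v hn, hxy])
    rw [one_smul] at h5
    have h6 := h2.symm.trans (h5.trans h4)
    rw [S.gen_of_inr pres lab v' hn, S.gen_of_inr pres lab v' hn, ← map_smul, ← map_smul] at h6
    exact smul_elim_inj h1 h3 (S.mkFiber_injective pres lab hn h6)

/-- At a label where `v i` is the identity the generators are distinct basis vectors, so a nonzero
multiple of one determines it. -/
theorem leftInverse_of_map_genSeq (Φ : S.sequences pres lab v ≃ₗ[R] S.sequences pres lab v')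
    {f g : ℕ → ℕ} {c d : ℕ → ∀ n, S.Residue n}
    (hf : ∀ x, ∀ᶠ n in cofinite, c x n ≠ 0 ∧
      (Φ (S.genSeq pres lab v x)).1 n = c x n • S.gen pres lab v' (f x) n)
    (hg : ∀ x, ∀ᶠ n in cofinite, d x n ≠ 0 ∧
      (Φ.symm (S.genSeq pres lab v' x)).1 n = d x n • S.gen pres lab v (g x) n)
    {i : I} (hi : ∀ x, v i x = some x) : Function.LeftInverse g f := by
  intro x
  obtain ⟨n, hn, ⟨h1, h2⟩, h3, h4⟩ :=
    ((hlab (.inr i)).and_eventually ((hf x).and (hg (f x)))).exists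
  have h5 := S.map_apply_smul Φ.symm.toLinearMap (w := Φ (S.genSeq pres lab v x))
    (w' := S.genSeq pres lab v' (f x)) h2
  have h6 : S.gen pres lab v x n = c x n • d (f x) n • S.gen pres lab v (g (f x)) n := by
    rw [← h4]
    simpa using h5
  rw [smul_smul, S.gen_of_inr pres lab v hn, S.gen_of_inr pres lab v hn, ← map_smul,
    ← one_smul (S.Residue n) (Option.elim (v i x) _ _)] at h6
  have h7 := smul_elim_inj one_ne_zero (mul_ne_zero h1 h3) (S.mkFiber_injective pres lab hn h6)
  rw [hi, hi] at h7
  exact (Option.some.inj h7).symm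

theorem exists_perm_of_sequences_equiv
    (Φ : S.sequences pres lab v ≃ₗ[R] S.sequences pres lab v') {i₀ : I}
    (hv : ∀ x, v i₀ x = some x) (hv' : ∀ x, v' i₀ x = some x) :
    ∃ f : ℕ ≃ ℕ, ∀ i, (∀ x, (v i x).isSome ↔ (v' i (f x)).isSome) ∧
      ∀ x y, v i x = v i y ↔ v' i (f x) = v' i (f y) := by
  choose f c hf using S.exists_map_genSeq hlab Φ
  choose g d hg using S.exists_map_genSeq hlab Φ.symm
  have h1 := S.leftInverse_of_map_genSeq hlab Φ hf hg hv
  have h2 := S.leftInverse_of_map_genSeq hlab Φ.symm hg hf hv'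
  refine ⟨⟨f, g, h1, h2⟩, fun i => ?_⟩
  obtain ⟨h3, h4⟩ := S.eq_of_map_genSeq hlab Φ hf i
  obtain ⟨h5, h6⟩ := S.eq_of_map_genSeq hlab Φ.symm hg i
  refine ⟨fun x => ⟨h3 x, fun h => ?_⟩, fun x y => ⟨h4 x y, fun h => ?_⟩⟩
  · have := h5 _ h
    rwa [Equiv.coe_fn_mk, h1] at this
  · have := h6 _ _ h
    rwa [Equiv.coe_fn_mk, h1, h1] at this

/-! #### Enumeration of the module -/

omit hlab in
theorem eventually_dfinsupp_eq_zero (d : Π₀ n, S.Fiber pres lab n) : ∀ᶠ n in cofinite, d n = 0 :=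
  d.finite_support

variable (pres lab v) in
omit hlab in
/-- The element of the product given by a combination and finitely many corrections. -/
noncomputable def seqOf (q : (ℕ →₀ S.LimitField) × Π₀ n, S.Fiber pres lab n) :
    S.sequences pres lab v :=
  ⟨fun n => S.comb pres lab v q.1 n + q.2 n, q.1, by
    filter_upwards [S.eventually_dfinsupp_eq_zero q.2] with n hn
    rw [hn, add_zero]⟩

omit hlab in
theorem seqOf_apply (q : (ℕ →₀ S.LimitField) × Π₀ n, S.Fiber pres lab n) (n : ℕ) :
    (S.seqOf pres lab v q).1 n = S.comb pres lab v q.1 n + q.2 n := rfl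

omit hlab in
theorem seqOf_surjective : Function.Surjective (S.seqOf pres lab v) := by
  classical
  intro w
  obtain ⟨κ, hκ⟩ := w.2
  have hfin : {n | ¬ w.1 n = S.comb pres lab v κ n}.Finite := hκ
  refine ⟨(κ, DFinsupp.mk hfin.toFinset fun n => w.1 n - S.comb pres lab v κ n), ?_⟩
  ext n
  rw [seqOf_apply, DFinsupp.mk_apply]
  split_ifs with h
  · exact add_sub_cancel _ _
  · rw [add_zero]
    simpa [eq_comm] using h

/-- Where `v i` is the identity and the corrections vanish, generators are independent and the
residues of coefficients can be read off. Distinct elements of the limit field have distinct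
residues almost everywhere. -/
theorem seqOf_injective {i : I} (hi : ∀ x, v i x = some x) :
    Function.Injective (S.seqOf pres lab v) := by
  classical
  rintro ⟨κ, d⟩ ⟨κ', d'⟩ h
  have hn : ∀ n, S.comb pres lab v κ n + d n = S.comb pres lab v κ' n + d' n := fun n =>
    congrFun (congrArg Subtype.val h) n
  have hκ : κ = κ' := by
    by_contra hne
    obtain ⟨x, hx⟩ := DFunLike.ne_iff.1 hne
    obtain ⟨n, h1, h2, h3, h4⟩ := ((hlab (.inr i)).and_eventually
      ((S.residue_ne hx).and ((S.eventually_dfinsupp_eq_zero d).and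
        (S.eventually_dfinsupp_eq_zero d')))).exists
    have h5 := hn n
    rw [h3, h4, add_zero, add_zero] at h5
    have hc : ∀ κ : ℕ →₀ S.LimitField, S.comb pres lab v κ n =
        S.mkFiber pres lab n (∑ x ∈ κ.support, Finsupp.single x (S.residue (κ x) n)) := by
      intro κ
      rw [S.comb_eq_sum pres lab v subset_rfl, map_sum]
      refine Finset.sum_congr rfl fun x _ => ?_
      rw [S.gen_of_inr pres lab v h1, hi, ← map_smul, Option.elim_some, Finsupp.smul_single,
        smul_eq_mul, mul_one]
    have hx : ∀ κ : ℕ →₀ S.LimitField,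
        (∑ x ∈ κ.support, Finsupp.single x (S.residue (κ x) n)) x = S.residue (κ x) n := by
      intro κ
      rw [Finsupp.finsetSum_apply]
      by_cases hκx : x ∈ κ.support
      · rw [Finset.sum_eq_single x (fun y _ hy => Finsupp.single_eq_of_ne' hy)
          (fun h => absurd hκx h), Finsupp.single_eq_same]
      · rw [Finset.sum_eq_zero fun y hy => Finsupp.single_eq_of_ne'
            (show y ≠ x from fun h => hκx (h ▸ hy)),
          Finsupp.notMem_support_iff.1 hκx, residue_zero]
    rw [hc, hc] at h5
    have h6 := DFunLike.congr_fun (S.mkFiber_injective pres lab h1 h5) x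
    rw [hx, hx] at h6
    exact h2 h6
  subst hκ
  rw [Prod.mk.injEq]
  exact ⟨rfl, DFinsupp.ext fun n => add_left_cancel (hn n)⟩

end MaximalSequence

end BorelComplexity

namespace BorelComplexity

universe u v

open Filter

/-! ### Enumerated modules as structures -/

section Values

variable {L : FirstOrder.Language.{u, v}}

/-- The value of a function symbol in a structure. -/
abbrev fnVal (M : Str L) {l : ℕ} (F : L.Functions l) (x : Fin l → ℕ) : ℕ :=
  @FirstOrder.Language.Structure.funMap L ℕ M l F x

/-- The truth value of a relation symbol in a structure. -/
abbrev relVal (M : Str L) {l : ℕ} (r : L.Relations l) (x : Fin l → ℕ) : Prop :=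
  @FirstOrder.Language.Structure.RelMap L ℕ M l r x

theorem iso_iff {M N : Str L} : Iso M N ↔ ∃ h : ℕ ≃ ℕ,
    (∀ (l : ℕ) (F : L.Functions l) (x : Fin l → ℕ), h (fnVal M F x) = fnVal N F (h ∘ x)) ∧
      ∀ (l : ℕ) (r : L.Relations l) (x : Fin l → ℕ), relVal N r (h ∘ x) ↔ relVal M r x := by
  constructor
  · rintro ⟨h⟩
    exact ⟨@FirstOrder.Language.Equiv.toEquiv L ℕ ℕ M N h,
      fun _ => @FirstOrder.Language.Equiv.map_fun' L ℕ ℕ M N h _,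
      fun _ => @FirstOrder.Language.Equiv.map_rel' L ℕ ℕ M N h _⟩
  · rintro ⟨h, hF, hR⟩
    exact ⟨@FirstOrder.Language.Equiv.mk L ℕ ℕ M N h (hF _) (hR _)⟩

end Values

section ModuleStructure

variable {R : Type u} [CommRing R] {A B : Type*} [AddCommGroup A] [Module R A] [AddCommGroup B]
  [Module R B]

/-- The structure on the natural numbers transported from a module. -/
@[reducible] def moduleStr (R : Type u) [CommRing R] [Module R A] (β : ℕ ≃ A) :
    Str (moduleLanguage R) where
  funMap {_} F := match F with
    | ModuleFunc.zero => fun _ => β.symm 0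
    | ModuleFunc.add => fun x => β.symm (β (x 0) + β (x 1))
    | ModuleFunc.smul r => fun x => β.symm (r • β (x 0))
  RelMap {_} r := nomatch (r : Empty)

theorem apply_realize_zeroT (β : ℕ ≃ A) {n : ℕ} (w : Fin n → ℕ) :
    β (@FirstOrder.Language.Term.realize _ ℕ (moduleStr R β) _ w zeroT) = 0 :=
  β.apply_symm_apply _

theorem apply_realize_addT (β : ℕ ≃ A) {n : ℕ} (w : Fin n → ℕ)
    (s t : (moduleLanguage R).Term (Fin n)) :
    β (@FirstOrder.Language.Term.realize _ ℕ (moduleStr R β) _ w (addT s t)) =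
      β (@FirstOrder.Language.Term.realize _ ℕ (moduleStr R β) _ w s) +
        β (@FirstOrder.Language.Term.realize _ ℕ (moduleStr R β) _ w t) :=
  β.apply_symm_apply _

theorem apply_realize_smulT (β : ℕ ≃ A) {n : ℕ} (w : Fin n → ℕ) (r : R)
    (t : (moduleLanguage R).Term (Fin n)) :
    β (@FirstOrder.Language.Term.realize _ ℕ (moduleStr R β) _ w (smulT r t)) =
      r • β (@FirstOrder.Language.Term.realize _ ℕ (moduleStr R β) _ w t) :=
  β.apply_symm_apply _

theorem realize_varT (β : ℕ ≃ A) {n : ℕ} (w : Fin n → ℕ) (i : Fin n) :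
    @FirstOrder.Language.Term.realize _ ℕ (moduleStr R β) _ w (varT i) = w i := rfl

theorem realize_equal_iff (β : ℕ ≃ A) {n : ℕ} (w : Fin n → ℕ)
    (s t : (moduleLanguage R).Term (Fin n)) :
    @InfFormula.Realize _ ℕ (moduleStr R β) n (.equal s t) w ↔
      β (@FirstOrder.Language.Term.realize _ ℕ (moduleStr R β) _ w s) =
        β (@FirstOrder.Language.Term.realize _ ℕ (moduleStr R β) _ w t) := by
  rw [β.apply_eq_iff_eq]
  rfl

theorem moduleStr_mem_mod (β : ℕ ≃ A) : moduleStr R β ∈ Mod (moduleTheory R) := by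
  intro φ hφ
  cases hφ with
  | exists_neg =>
    intro a h
    refine h (β.symm (-β a)) ?_
    rw [realize_equal_iff, apply_realize_addT, apply_realize_zeroT, realize_varT, realize_varT]
    simp [Fin.snoc]
  | add_assoc =>
    intro a b c
    rw [realize_equal_iff]
    simp only [apply_realize_addT, add_assoc]
  | add_comm =>
    intro a b
    rw [realize_equal_iff]
    simp only [apply_realize_addT, add_comm]
  | zero_add =>
    intro a
    rw [realize_equal_iff]
    simp only [apply_realize_addT, apply_realize_zeroT, zero_add]
  | smul_add r =>
    intro a b
    rw [realize_equal_iff]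
    simp only [apply_realize_addT, apply_realize_smulT, smul_add]
  | add_smul r s =>
    intro a
    rw [realize_equal_iff]
    simp only [apply_realize_addT, apply_realize_smulT, add_smul]
  | mul_smul r s =>
    intro a
    rw [realize_equal_iff]
    simp only [apply_realize_smulT, mul_smul]
  | one_smul =>
    intro a
    rw [realize_equal_iff]
    simp only [apply_realize_smulT, one_smul]

theorem iso_moduleStr_iff (β : ℕ ≃ A) (γ : ℕ ≃ B) :
    Iso (moduleStr R β) (moduleStr R γ) ↔ Nonempty (A ≃ₗ[R] B) := by
  rw [iso_iff]
  constructor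
  · rintro ⟨h, hF, -⟩
    have hadd : ∀ a b : ℕ, h (β.symm (β a + β b)) = γ.symm (γ (h a) + γ (h b)) := fun a b =>
      hF 2 ModuleFunc.add ![a, b]
    have hsmul : ∀ (r : R) (a : ℕ), h (β.symm (r • β a)) = γ.symm (r • γ (h a)) := fun r a =>
      hF 1 (ModuleFunc.smul r) ![a]
    exact ⟨{ (β.symm.trans h).trans γ with
      map_add' := fun x y => by simpa using congrArg γ (hadd (β.symm x) (β.symm y))
      map_smul' := fun r x => by simpa using congrArg γ (hsmul r (β.symm x)) }⟩
  · rintro ⟨Φ⟩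
    refine ⟨(β.trans Φ.toEquiv).trans γ.symm, fun n F x => ?_, fun n r => nomatch (r : Empty)⟩
    change ModuleFunc R n at F
    cases F with
    | zero =>
      change γ.symm (Φ (β (β.symm 0))) = γ.symm 0
      simp
    | add =>
      change γ.symm (Φ (β (β.symm (β (x 0) + β (x 1))))) =
        γ.symm (γ (γ.symm (Φ (β (x 0)))) + γ (γ.symm (Φ (β (x 1)))))
      simp
    | smul r =>
      change γ.symm (Φ (β (β.symm (r • β (x 0))))) = γ.symm (r • γ (γ.symm (Φ (β (x 0)))))
      simp

instance [Countable R] (l : ℕ) : Countable ((moduleLanguage R).Functions l) := by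
  let code : ModuleFunc R l → Option (Option R) := fun F => match F with
    | .zero => none
    | .add => some none
    | .smul r => some (some r)
  have : Function.Injective code := by
    intro F G h
    cases F <;> cases G <;> simp_all [code]
  exact this.countable

-- With no relation symbols, the topology is no finer than the one induced from a countable power of
-- `ℕ`, whose Borel sets are generated by the coordinates.
omit [CommRing R] in
theorem measurable_toStr [Countable R] {X : Type*} [MeasurableSpace X]
    {F : X → Str (moduleLanguage R)}
    (hF : ∀ (l : ℕ) (f : (moduleLanguage R).Functions l) (x : Fin l → ℕ),
      Measurable fun M => fnVal (F M) f x) : Measurable F := by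
  let e : Str (moduleLanguage R) →
      ((q : Σ l, (moduleLanguage R).Functions l × (Fin l → ℕ)) → ℕ) :=
    fun M q => fnVal M q.2.1 q.2.2
  have hle : TopologicalSpace.induced e inferInstance ≤ strTopology (moduleLanguage R) := by
    refine le_inf (le_iInf fun l => le_iInf fun f => le_iInf fun x => ?_)
      (le_iInf fun l => le_iInf fun r => nomatch (r : Empty))
    have h1 : @Continuous _ _ (TopologicalSpace.induced e inferInstance) ⊥ fun M =>
        e M ⟨l, f, x⟩ := by
      have h2 : Continuous fun g : (Σ l, (moduleLanguage R).Functions l × (Fin l → ℕ)) → ℕ =>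
          g ⟨l, f, x⟩ := continuous_apply _
      exact @Continuous.comp _ _ _ (TopologicalSpace.induced e inferInstance) _ _ _ _ h2
        continuous_induced_dom
    exact continuous_iff_le_induced.1 h1
  refine measurable_of_isOpen fun U hU => ?_
  obtain ⟨V, hV, rfl⟩ := isOpen_induced_iff.1 (hle U hU)
  have he : Measurable fun M => e (F M) := measurable_pi_iff.2 fun q => hF _ _ _
  exact he hV.measurableSet

end ModuleStructure

/-! ### Coding structures -/

section Coding

variable {L : FirstOrder.Language.{0, 0}}

theorem measurableSet_funMap {l : ℕ} (F : L.Functions l) (x : Fin l → ℕ) (b : ℕ) :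
    MeasurableSet {M : Str L | fnVal M F x = b} := by
  refine IsOpen.measurableSet ?_
  have h : strTopology L ≤ TopologicalSpace.induced (fun M : Str L => fnVal M F x) ⊥ :=
    inf_le_left.trans ((iInf_le _ l).trans ((iInf_le _ F).trans (iInf_le _ x)))
  exact h _ ⟨{b}, trivial, rfl⟩

theorem measurableSet_relMap {l : ℕ} (r : L.Relations l) (x : Fin l → ℕ) :
    MeasurableSet {M : Str L | relVal M r x} := by
  refine IsOpen.measurableSet ?_
  have h : strTopology L ≤ TopologicalSpace.induced (fun M : Str L => relVal M r x) ⊥ :=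
    inf_le_right.trans ((iInf_le _ l).trans ((iInf_le _ r).trans (iInf_le _ x)))
  exact h _ ⟨{True}, trivial, by ext; simp⟩

/-- A list belongs to the graph of a function symbol or to the relation of a relation symbol. -/
def Holds (M : Str L) : L.Symbols → List ℕ → Prop
  | .inl F, m => ∃ x : Fin F.1 → ℕ, m = List.ofFn x ++ [fnVal M F.2 x]
  | .inr r, m => ∃ x : Fin r.1 → ℕ, m = List.ofFn x ∧ relVal M r.2 x

theorem measurableSet_holds (s : L.Symbols) (m : List ℕ) :
    MeasurableSet {M : Str L | Holds M s m} := by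
  rcases s with F | r
  · have : {M : Str L | Holds M (.inl F) m} =
        ⋃ x : Fin F.1 → ℕ, ⋃ b : ℕ, {M | m = List.ofFn x ++ [b] ∧ fnVal M F.2 x = b} := by
      ext M
      simp [Holds]
    rw [this]
    refine .iUnion fun x => .iUnion fun b => ?_
    exact (MeasurableSet.const _).inter (measurableSet_funMap F.2 x b)
  · have : {M : Str L | Holds M (.inr r) m} =
        ⋃ x : Fin r.1 → ℕ, {M | m = List.ofFn x ∧ relVal M r.2 x} := by
      ext M
      simp [Holds]
    rw [this]
    exact .iUnion fun x => (MeasurableSet.const _).inter (measurableSet_relMap r.2 x)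

theorem iso_iff_holds {M N : Str L} :
    Iso M N ↔ ∃ h : ℕ ≃ ℕ, ∀ s m, Holds N s (m.map h) ↔ Holds M s m := by
  rw [iso_iff]
  constructor
  · rintro ⟨h, hfun, hrel⟩
    have hinv : ∀ {l : ℕ} (x : Fin l → ℕ), h ∘ (h.symm ∘ x) = x := fun x => by
      ext; simp
    refine ⟨h, fun s m => ?_⟩
    have hmap : Function.Injective (List.map h) :=
      List.map_injective_iff.2 h.injective
    rcases s with ⟨l, F⟩ | ⟨l, r⟩
    · constructor
      · rintro ⟨x, hx⟩
        refine ⟨h.symm ∘ x, hmap ?_⟩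
        rw [hx, List.map_append, List.map_ofFn, hinv, List.map_singleton, hfun, hinv]
      · rintro ⟨x, rfl⟩
        exact ⟨h ∘ x, by
          rw [List.map_append, List.map_ofFn, List.map_singleton, hfun]⟩
    · constructor
      · rintro ⟨x, hx, hr⟩
        refine ⟨h.symm ∘ x, hmap ?_, ?_⟩
        · rw [hx, List.map_ofFn, hinv]
        · rwa [← hrel, hinv]
      · rintro ⟨x, rfl, hr⟩
        exact ⟨h ∘ x, List.map_ofFn, (hrel _ _ _).2 hr⟩
  · rintro ⟨h, hh⟩
    refine ⟨h, ?_, ?_⟩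
    · intro l F x
      obtain ⟨y, hy⟩ := (hh (.inl ⟨l, F⟩) _).2 ⟨x, rfl⟩
      rw [List.map_append, List.map_ofFn] at hy
      obtain ⟨h1, h2⟩ := List.append_inj hy (by simp)
      rw [List.ofFn_injective h1]
      simpa using h2
    · intro l r x
      constructor
      · intro hr
        obtain ⟨y, hy, hr'⟩ := (hh (.inr ⟨l, r⟩) (List.ofFn x)).1
          ⟨h ∘ x, List.map_ofFn, hr⟩
        rwa [List.ofFn_injective hy]
      · intro hr
        obtain ⟨y, hy, hr'⟩ := (hh (.inr ⟨l, r⟩) _).2 ⟨x, rfl, hr⟩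
        rw [List.map_ofFn] at hy
        rwa [List.ofFn_injective hy]

/-- The indices of the partial functions that code a structure. -/
abbrev CodeIndex (L : FirstOrder.Language.{0, 0}) : Type := Option (ℕ ⊕ Option L.Symbols)

open Classical in
/-- The partial functions that code a structure: the identity, the coordinates of the lists, and
the characteristic functions of the points and of the basic relations. -/
noncomputable def coding (p : ℕ → ℕ ⊕ List ℕ) (M : Str L) : CodeIndex L → ℕ → Option ℕ
  | none, x => some x
  | some (.inl j), x => (p x).elim some fun m => m[j]?
  | some (.inr none), x => if (p x).isLeft then some 0 else none
  | some (.inr (some s)), x =>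
      (p x).elim (fun _ => none) fun m => if Holds M s m then some 0 else none

theorem measurableSet_coding (p : ℕ → ℕ ⊕ List ℕ) (i : CodeIndex L) (x : ℕ) (o : Option ℕ) :
    MeasurableSet {M : Str L | coding p M i x = o} := by
  rcases i with _ | j | _ | s
  · exact MeasurableSet.const (some x = o)
  · exact MeasurableSet.const ((p x).elim some (fun m => m[j]?) = o)
  · exact MeasurableSet.const ((if (p x).isLeft then some 0 else none) = o)
  · rcases hx : p x with a | m
    · simp only [coding, hx, Sum.elim_inl]
      exact MeasurableSet.const (none = o)
    · have : {M : Str L | coding p M (some (.inr (some s))) x = o} =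
          ({M | Holds M s m} ∩ {_M | some 0 = o}) ∪ ({M | Holds M s m}ᶜ ∩ {_M | none = o}) := by
        ext M
        by_cases h : Holds M s m <;> simp [coding, hx, h]
      rw [this]
      exact ((measurableSet_holds s m).inter (.const _)).union
        ((measurableSet_holds s m).compl.inter (.const _))

theorem exists_perm_coding {p : ℕ → ℕ ⊕ List ℕ} {M N : Str L} {h : ℕ ≃ ℕ}
    (hh : ∀ s m, Holds N s (m.map h) ↔ Holds M s m) {f : ℕ ≃ ℕ}
    (hf : ∀ x, p (f x) = Equiv.sumCongr h (Equiv.listEquivOfEquiv h) (p x)) :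
    ∃ π : CodeIndex L → ℕ ≃ ℕ, ∀ i x, coding p N i (f x) = (coding p M i x).map (π i) := by
  refine ⟨fun i => match i with
    | none => f
    | some (.inl _) => h
    | some (.inr _) => .refl ℕ, fun i x => ?_⟩
  have hx := hf x
  rcases i with _ | j | _ | s
  · rfl
  · rcases hp : p x with a | m <;> rw [hp] at hx <;>
      simp [coding, hp, hx, Equiv.listEquivOfEquiv]
  · rcases hp : p x with a | m <;> rw [hp] at hx <;> simp [coding, hp, hx]
  · rcases hp : p x with a | m <;> rw [hp] at hx
    · simp [coding, hp, hx]
    · by_cases hm : Holds M s m <;> simp [coding, hp, hx, Equiv.listEquivOfEquiv, hh, hm]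

/-- One domain separates points from lists. A list and a point share their value under the `j`-th
coordinate function exactly when the point is the `j`-th entry, so `f` induces a permutation of the
points and acts on lists entrywise. The remaining domains then transport `Holds`. -/
theorem exists_holds_iff_of_coding {p : ℕ → ℕ ⊕ List ℕ} (hp : Function.Surjective p)
    {M N : Str L} {f : ℕ ≃ ℕ}
    (hf : ∀ i, (∀ x, (coding p M i x).isSome ↔ (coding p N i (f x)).isSome) ∧
      ∀ x y, coding p M i x = coding p M i y ↔ coding p N i (f x) = coding p N i (f y)) :
    ∃ h : ℕ ≃ ℕ, ∀ s m, Holds N s (m.map h) ↔ Holds M s m := by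
  have hleft : ∀ x, (p x).isLeft ↔ (p (f x)).isLeft := by
    intro x
    have := (hf (some (.inr none))).1 x
    rcases hx : p x with a | m <;> rcases hy : p (f x) with b | m' <;>
      simp [coding, hx, hy] at this ⊢
  choose pt hpt using fun a : ℕ => hp (.inl a)
  have h1 : ∀ a, ∃ b, p (f (pt a)) = .inl b := fun a =>
    Sum.isLeft_iff.1 ((hleft _).1 (by rw [hpt]; rfl))
  choose h hh using h1
  have hpoint : ∀ a x, p x = .inl a → p (f x) = .inl (h a) := by
    intro a x hx
    obtain ⟨b, hb⟩ := Sum.isLeft_iff.1 ((hleft x).1 (by rw [hx]; rfl))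
    -- Many numbers represent the same point; every coordinate function identifies them, and `0` is
    -- an arbitrary choice.
    have := ((hf (some (.inl 0))).2 x (pt a)).1 (by simp [coding, hx, hpt])
    simp only [coding, hb, hh, Sum.elim_inl, Option.some.injEq] at this
    rw [hb, this]
  have hlist : ∀ m x, p x = .inr m → p (f x) = .inr (m.map h) := by
    intro m x hx
    rcases hfx : p (f x) with b | m'
    · have := (hleft x).2 (by rw [hfx]; rfl)
      simp [hx] at this
    · congr 1
      refine List.ext_getElem? fun j => ?_
      rw [List.getElem?_map]
      obtain ⟨h2, h3⟩ := hf (some (.inl j))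
      rcases hj : m[j]? with _ | a
      · have := h2 x
        simp only [coding, hx, hfx, Sum.elim_inr, hj] at this
        simpa using this
      · have := (h3 x (pt a)).1 (by simp [coding, hx, hpt, hj])
        simpa [coding, hfx, hh] using this
  have hbij : Function.Bijective h := by
    constructor
    · intro a b hab
      have := ((hf (some (.inl 0))).2 (pt a) (pt b)).2 (by simp [coding, hh, hab])
      simpa [coding, hpt] using this
    · intro b
      obtain ⟨x, hx⟩ := hp (.inl b)
      obtain ⟨a, ha⟩ := Sum.isLeft_iff.1 ((hleft (f.symm x)).2 (by simp [hx]))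
      have := hpoint a _ ha
      rw [f.apply_symm_apply, hx] at this
      exact ⟨a, (Sum.inl.inj this).symm⟩
  refine ⟨Equiv.ofBijective h hbij, fun s m => ?_⟩
  obtain ⟨x, hx⟩ := hp (.inr m)
  have := (hf (some (.inr (some s)))).1 x
  simp only [coding, hx, hlist m x hx, Sum.elim_inr] at this
  rw [Equiv.coe_ofBijective]
  split_ifs at this <;> simp_all

end Coding

end BorelComplexity

namespace BorelComplexity

universe u

open Filter

/-! ### The reduction -/

namespace MaximalSequence

variable {R : Type u} [CommRing R] (S : MaximalSequence R) {I : Type*}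
  (pres : ℕ → Finset (List ℕ × List ℕ)) (lab : ℕ → S.Label I) {X : Type*} [MeasurableSpace X]
  {v : X → I → ℕ → Option ℕ}

instance (n : ℕ) : MeasurableSpace (S.Fiber pres lab n) := ⊤

instance (n : ℕ) : DiscreteMeasurableSpace (S.Fiber pres lab n) := ⟨fun _ => trivial⟩

instance [Countable R] (n : ℕ) : MeasurableAdd₂ (S.Fiber pres lab n) := ⟨.of_discrete⟩

theorem measurable_gen (hv : ∀ i x o, MeasurableSet {M | v M i x = o}) (x n : ℕ) :
    Measurable fun M => S.gen pres lab (v M) x n := by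
  rcases hl : lab n with q | i
  · have : (fun M => S.gen pres lab (v M) x n) =
        fun _ => S.mkFiber pres lab n (.single x 1) := by
      ext M
      rw [gen, hl]
      rfl
    rw [this]
    exact measurable_const
  · let : MeasurableSpace (Option ℕ) := ⊤
    have : DiscreteMeasurableSpace (Option ℕ) := ⟨fun _ => trivial⟩
    have h : Measurable fun M => v M i x := measurable_to_countable' fun o => hv i x o
    have : (fun M => S.gen pres lab (v M) x n) =
        (fun o => S.mkFiber pres lab n (Option.elim o 0 fun b => .single b 1)) ∘
          fun M => v M i x := by
      ext M
      exact S.gen_of_inr pres lab (v M) hl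
    rw [this]
    exact Measurable.of_discrete.comp h

theorem measurable_seqOf [Countable R] (hv : ∀ i x o, MeasurableSet {M | v M i x = o})
    (q : (ℕ →₀ S.LimitField) × Π₀ n, S.Fiber pres lab n) (n : ℕ) :
    Measurable fun M => (S.seqOf pres lab (v M) q).1 n := by
  simp only [seqOf_apply, comb, Finsupp.sum]
  refine Measurable.add (Finset.measurable_sum _ fun x _ => ?_) measurable_const
  exact Measurable.of_discrete.comp (S.measurable_gen pres lab hv x n)

/-- The parameters `e` do not depend on `M`, so an element has index `b` exactly when it agrees at
each coordinate with the sequence of parameter `e b`: countably many Borel conditions. -/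
theorem measurable_moduleStr [Countable R] (hv : ∀ i x o, MeasurableSet {M | v M i x = o})
    {β : ∀ M, ℕ ≃ S.sequences pres lab (v M)}
    {e : ℕ → (ℕ →₀ S.LimitField) × Π₀ n, S.Fiber pres lab n}
    (hβ : ∀ M a, β M a = S.seqOf pres lab (v M) (e a)) :
    Measurable fun M => moduleStr R (β M) := by
  have hcoord : ∀ a n, Measurable fun M => (β M a).1 n := fun a n => by
    simp only [hβ]
    exact S.measurable_seqOf pres lab hv (e a) n
  have key : ∀ g : ∀ M, S.sequences pres lab (v M), (∀ n, Measurable fun M => (g M).1 n) →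
      Measurable fun M => (β M).symm (g M) := by
    intro g hg
    refine measurable_to_countable' fun b => ?_
    have : (fun M => (β M).symm (g M)) ⁻¹' {b} = ⋂ n, {M | (g M).1 n = (β M b).1 n} := by
      ext M
      simp only [Set.mem_preimage, Set.mem_singleton_iff, Set.mem_iInter, Equiv.symm_apply_eq]
      exact Subtype.ext_iff.trans funext_iff
    rw [this]
    refine .iInter fun n => ?_
    exact ((hg n).prodMk (hcoord b n)) (MeasurableSet.of_discrete (s := {q | q.1 = q.2}))
  refine measurable_toStr fun l F x => ?_
  change ModuleFunc R l at F
  cases F with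
  | zero => exact key (fun M => 0) fun n => measurable_const
  | add => exact key (fun M => β M (x 0) + β M (x 1)) fun n => (hcoord _ n).add (hcoord _ n)
  | smul r =>
    exact key (fun M => r • β M (x 0)) fun n =>
      (Measurable.of_discrete (f := fun w => r • w)).comp (hcoord _ n)

end MaximalSequence

theorem exists_frequently_eq (T : Type*) [Countable T] [Nonempty T] :
    ∃ lab : ℕ → T, ∀ t, ∃ᶠ n in cofinite, lab n = t := by
  obtain ⟨p, _, h⟩ := exists_generic T
  refine ⟨p, fun t => ?_⟩
  rw [Nat.cofinite_eq_atTop, frequently_atTop]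
  intro N
  obtain ⟨n, hn, hp, -⟩ := h t ∅ N
  exact ⟨n, hn, hp⟩

/-- Isomorphism of countable structures is Borel reducible to isomorphism of countable modules. -/
theorem exists_measurable_reduction {R : Type u} [CommRing R] [Countable R]
    [Infinite (MaximalSpectrum R)] (L : FirstOrder.Language.{0, 0}) [Countable L.Symbols] :
    ∃ F : Str L → Str (moduleLanguage R), Measurable F ∧
      (∀ M, F M ∈ Mod (moduleTheory R)) ∧ ∀ M N, Iso (F M) (F N) ↔ Iso M N := by
  obtain ⟨S⟩ := exists_maximalSequence (R := R)
  obtain ⟨p, pres, hgen⟩ := exists_generic (ℕ ⊕ List ℕ)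
  obtain ⟨lab, hlab⟩ := exists_frequently_eq (S.Label (CodeIndex L))
  have hp : Function.Surjective p := fun t =>
    let ⟨n, _, hn, _⟩ := hgen t ∅ 0
    ⟨n, hn⟩
  obtain ⟨e⟩ : Nonempty (ℕ ≃ (ℕ →₀ S.LimitField) × Π₀ n, S.Fiber pres lab n) := by
    have : Infinite (ℕ →₀ S.LimitField) := inferInstance
    exact nonempty_equiv_of_countable
  have hcode : ∀ (M : Str L) (x : ℕ), coding p M none x = some x := fun _ _ => rfl
  let β : ∀ M : Str L, ℕ ≃ S.sequences pres lab (coding p M) := fun M =>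
    e.trans (Equiv.ofBijective (S.seqOf pres lab (coding p M))
      ⟨S.seqOf_injective hlab (hcode M), S.seqOf_surjective⟩)
  refine ⟨fun M => moduleStr R (β M), S.measurable_moduleStr pres lab
    (fun i x o => measurableSet_coding p i x o) (fun M a => rfl),
    fun M => moduleStr_mem_mod (β M), fun M N => ?_⟩
  rw [iso_moduleStr_iff, iso_iff_holds]
  constructor
  · rintro ⟨Φ⟩
    obtain ⟨f, hf⟩ := S.exists_perm_of_sequences_equiv hlab Φ (hcode M) (hcode N)
    exact exists_holds_iff_of_coding hp hf
  · rintro ⟨h, hh⟩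
    obtain ⟨f, hf, hcol⟩ := exists_lift hgen (Equiv.sumCongr h (Equiv.listEquivOfEquiv h))
    obtain ⟨π, hπ⟩ := exists_perm_coding hh hf
    exact S.nonempty_sequences_equiv hcol hπ

end BorelComplexity

theorem mainTheorem9 {R : Type*} [CommRing R] [Countable R]
    (hR : Infinite (MaximalSpectrum R)) :
    BorelComplexity.BorelComplete (BorelComplexity.moduleTheory R) := by
  intro L _ T _
  obtain ⟨F, hF, hmod, hiso⟩ := BorelComplexity.exists_measurable_reduction (R := R) L
  exact ⟨fun M => ⟨F M, hmod M⟩, (hF.comp measurable_subtype_coe).subtype_mk,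
    fun M N => hiso M N⟩
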